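/- **Hybrid completeness for $\mathcal H_\Sigma(@_z,\forall)$.** *Language.* Let $(S,\Sigma)$ be a many-sorted signature, with operation symbols $\sigma\in\Sigma_{s_1\cdots s_n,s}$ ($n\ge 0$), and let $\mathrm{PROP}=(\mathrm{PROP}_s)_{s\in S}$, $\mathrm{NOM}=(\mathrm{NOM}_s)_{s\in S}$, $\mathrm{SVAR}=(\mathrm{SVAR}_s)_{s\in S}$ be $S$-sorted sets of propositional variables, nominals and state variables, all symbols of different kinds or sorts being distinct and every $\mathrm{SVAR}_s$ being infinite. A *state symbol* is a nominal or a state variable. Formulas of sort $s$ are $$\phi_s ::= p\mid j\mid y\mid\neg\phi_s\mid\phi_s\vee\phi_s\mid\sigma(\phi_{s_1},\dots,\phi_{s_n})\mid\forall x\,\phi_s\mid @_z^s\psi_t ,$$ with $p\in\mathrm{PROP}_s$, $j\in\mathrm{NOM}_s$, $y\in\mathrm{SVAR}_s$, $\sigma\in\Sigma_{s_1\cdots s_n,s}$, $x$ a state variable of any sort, $z$ a state symbol of any sort $t$ and $\psi_t$ a formula of sort $t$. The connectives $\wedge,\to,\leftrightarrow$ are defined as usual, $\exists x\,\phi:=\neg\forall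 x\,\neg\phi$ and $\sigma^{\Box}(\phi_1,\dots,\phi_n):=\neg\sigma(\neg\phi_1,\dots,\neg\phi_n)$. An occurrence of $x$ as the index of an operator $@_x$ is an occurrence of $x$; only $\forall x$ binds $x$. $\phi[y/x]$ is the result of replacing the free occurrences of the state variable $x$ by the state symbol $y$ of the same sort; $y$ is substitutable for $x$ in $\phi$ if no free occurrence of $x$ in $\phi$ lies in the scope of a quantifier $\forall y$. *Semantics.* A model $\mathcal M=(W,(R_\sigma)_{\sigma\in\Sigma},V)$ consists of nonempty sets $W_s$ ($s\in S$), relations $R_\sigma\subseteq W_s\times W_{s_1}\times\dots\times W_{s_n}$ for $\sigma\in\Sigma_{s_1\cdots s_n,s}$, sets $V_s(p)\subseteq W_s$ for $p\in \mathrm{PROP}_s$ and singletons $V_s(j)\subseteq W_s$ for $j\in\mathrm{NOM}_s$. An assignment is an $S$-sorted function $g:\mathrm{SVAR}\to W$. The denotation $\mathrm{Den}_g(z)$ is $g(z)$ if $z$ is a state variable and the element of $V(z)$ if $z$ is a nominal. For $w\in W_s$ and $\phi$ of sort $s$, satisfaction $\mathcal M,g,w\models\phi$ is defined by: $p$ holds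 iff $w\in V_s(p)$; a state symbol $z$ holds iff $w=\mathrm{Den}_g(z)$; $\neg$ and $\vee$ are classical; $\sigma(\phi_1,\dots,\phi_n)$ holds iff there are $w_i\in W_{s_i}$ with $R_\sigma ww_1\cdots w_n$ and $\mathcal M,g,w_i\models\phi_i$ for all $i$; $\forall x\,\phi$ holds iff $\mathcal M,g',w\models\phi$ for every assignment $g'$ that differs from $g$ at most at $x$; $@_z^s\phi$ holds iff $\mathcal M,g,\mathrm{Den}_g(z)\models\phi$. A set $\Gamma$ of formulas of sort $s$ is *satisfiable* if there are $\mathcal M$, $g$ and $w\in W_s$ with $\mathcal M,g,w\models\phi$ for all $\phi\in\Gamma$. *Deductive system.* In the following $y,z$ are state symbols and $x$ is a state variable. The axioms are, whenever the sorts match, all instances of propositional tautologies and of - $(K_\sigma)$ $\sigma^\Box(\dots,\phi\to\chi,\dots)\to(\sigma^\Box(\dots,\phi,\dots)\to\sigma^\Box(\dots,\chi,\dots))$; - $(Dual_\sigma)$ $\sigma(\phi_1,\dots,\phi_n)\leftrightarrow\neg\sigma^\Box(\neg\phi_1,\dots,\neg\phi_n)$; - $(K@)$ $@^s_z(\phi\to\psi)\to(@^s_z\phi\to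 @^s_z\psi)$; - $(Agree)$ $@^t_y@^{t'}_z\phi\leftrightarrow @^t_z\phi$; - $(SelfDual)$ $@^s_z\phi\leftrightarrow\neg @^s_z\neg\phi$; - $(Intro)$ $z\to(\phi\leftrightarrow @^s_z\phi)$, with $z$ and $\phi$ of sort $s$; - $(Back)$ $\sigma(\dots,@^{s_i}_z\psi,\dots)\to @^s_z\psi$, for $\sigma\in\Sigma_{s_1\cdots s_n,s}$; - $(Ref)$ $@^s_zz$; - $(Q1)$ $\forall x(\phi\to\psi)\to(\phi\to\forall x\,\psi)$ if $x$ is not free in $\phi$; - $(Q2)$ $\forall x\,\phi\to\phi[y/x]$ if $y$ is substitutable for $x$ in $\phi$; - $(Name)$ $\exists x\,x$; - $(Barcan)$ $\forall x\,\sigma^\Box(\phi_1,\dots,\phi_n)\to\sigma^\Box(\phi_1,\dots,\forall x\,\phi_i,\dots,\phi_n)$ if $x$ is not free in $\phi_k$ for any $k\ne i$; - $(Barcan@)$ $\forall x\,@^s_z\phi\to @^s_z\forall x\,\phi$ if $x\neq z$; - $(Nom\,x)$ $@^s_zx\wedge @^s_yx\to @^s_zy$. The rules are - $(MP)$ from $\phi$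 and $\phi\to\psi$ infer $\psi$; - $(UG)$ from $\phi_i$ infer $\sigma^\Box(\phi_1,\dots,\phi_n)$; - $(BroadcastS)$ from $@^s_z\phi$ infer $@^{s'}_z\phi$; - $(Gen@)$ from $\phi$ infer $@^s_z\phi$, where $z$ and $\phi$ have the same sort; - $(Paste0)$ from $@^s_z(y\wedge\phi)\to\psi$ infer $@^s_z\phi\to\psi$, if $y\neq z$ and $y$ does not occur in $\phi$ or $\psi$; - $(Paste1)$ from $@^s_z\sigma(\phi_1,\dots,y\wedge\phi_i,\dots,\phi_n)\to\psi$ infer $@^s_z\sigma(\phi_1,\dots,\phi_n)\to\psi$, if $y\ne z$ and $y$ does not occur in $\phi_1,\dots,\phi_n$ or $\psi$; - $(Gen)$ from $\phi$ infer $\forall x\,\phi$. A formula $\phi$ is *deducible* from a set $\Gamma$ of formulas of the same sort if $\psi_1\to(\psi_2\to\cdots\to(\psi_m\to\phi))$ is a theorem for some $m\ge 0$ and $\psi_1,\dots,\psi_m\in\Gamma$; $\Gamma$ is *consistent* if there is no $\phi$ such that both $\phi$ and $\neg\phi$ are deducible from $\Gamma$. **Theorem.** For every sort $s\in S$, every consistent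 set $\Gamma$ of formulas of sort $s$ of $\mathcal H_\Sigma(@_z,\forall)$ is satisfiable. -/

import Mathlib

/-!  Many-sorted hybrid logic with satisfaction operators indexed by nominals and state variables
and with the binder `∀` over state variables. -/

universe u

namespace HybridLogic

/-- A many-sorted signature `(S, Σ)` together with the `S`-sorted sets of propositional variables,
nominals and state variables. `Op n d s` is the set of operation symbols
`σ : d 0 ⋯ d (n - 1) → s`. The sorted sets are families of types, so that symbols of
distinct sorts are distinct. -/
structure Signature where
  /-- sorts -/
  S : Type u
  /-- operation symbols -/
  Op : (n : ℕ) → (Fin n → S) → S → Type u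
  /-- propositional variables -/
  PROP : S → Type u
  /-- nominals -/
  NOM : S → Type u
  /-- state variables -/
  SVAR : S → Type u

/-- A state symbol is a nominal or a state variable. -/
inductive StateSymbol (L : Signature.{u}) (s : L.S) : Type u
  | nom (j : L.NOM s) : StateSymbol L s
  | svar (x : L.SVAR s) : StateSymbol L s

/-- Formulas of each sort. `sym z` is the state symbol `z` taken as a formula and
`sat s z ψ` is `@_z^s ψ`. -/
inductive Form (L : Signature.{u}) : L.S → Type u
  | prop {s : L.S} (p : L.PROP s) : Form L s
  | sym {s : L.S} (z : StateSymbol L s) : Form L s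
  | neg {s : L.S} (φ : Form L s) : Form L s
  | or {s : L.S} (φ ψ : Form L s) : Form L s
  | op {n : ℕ} {d : Fin n → L.S} {s : L.S} (σ : L.Op n d s)
      (φ : (i : Fin n) → Form L (d i)) : Form L s
  | all {s t : L.S} (x : L.SVAR t) (φ : Form L s) : Form L s
  | sat {t : L.S} (s : L.S) (z : StateSymbol L t) (ψ : Form L t) : Form L s

namespace Form

variable {L : Signature.{u}}

/-- The state variable `x` as a formula. -/
def var {s : L.S} (x : L.SVAR s) : Form L s := sym (.svar x)

def imp {s : L.S} (φ ψ : Form L s) : Form L s := or (neg φ) ψ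

def and {s : L.S} (φ ψ : Form L s) : Form L s := neg (or (neg φ) (neg ψ))

def iff {s : L.S} (φ ψ : Form L s) : Form L s := and (imp φ ψ) (imp ψ φ)

/-- The dual operation `σ^□ (φ₁, …, φₙ) := ¬ σ (¬ φ₁, …, ¬ φₙ)`. -/
def box {n : ℕ} {d : Fin n → L.S} {s : L.S} (σ : L.Op n d s)
    (φ : (i : Fin n) → Form L (d i)) : Form L s := neg (op σ fun i => neg (φ i))

/-- The dual binder `∃ x φ := ¬ ∀ x ¬ φ`. -/
def ex {s t : L.S} (x : L.SVAR t) (φ : Form L s) : Form L s := neg (all x (neg φ))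

/-- The state symbol `z` occurs in the formula (free, bound, right after a quantifier, or as the
index of a satisfaction operator). Symbols of possibly different sorts are compared as elements
of the disjoint union over all sorts. -/
def Occurs {t : L.S} (z : StateSymbol L t) : {s : L.S} → Form L s → Prop
  | _, prop _ => False
  | s, sym y => (⟨t, z⟩ : Σ r, StateSymbol L r) = ⟨s, y⟩
  | _, neg φ => Occurs z φ
  | _, or φ ψ => Occurs z φ ∨ Occurs z ψ
  | _, op _ φ => ∃ i, Occurs z (φ i)
  | _, @all _ _ r y φ => (⟨t, z⟩ : Σ r, StateSymbol L r) = ⟨r, .svar y⟩ ∨ Occurs z φ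
  | _, @sat _ r _ y φ => (⟨t, z⟩ : Σ r, StateSymbol L r) = ⟨r, y⟩ ∨ Occurs z φ

/-- The state variable `x` has a free occurrence in the formula. -/
def Free {t : L.S} (x : L.SVAR t) : {s : L.S} → Form L s → Prop
  | _, prop _ => False
  | s, sym y => (⟨t, .svar x⟩ : Σ r, StateSymbol L r) = ⟨s, y⟩
  | _, neg φ => Free x φ
  | _, or φ ψ => Free x φ ∨ Free x ψ
  | _, op _ φ => ∃ i, Free x (φ i)
  | _, @all _ _ r y φ => (⟨t, x⟩ : Σ r, L.SVAR r) ≠ ⟨r, y⟩ ∧ Free x φ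
  | _, @sat _ r _ y φ => (⟨t, .svar x⟩ : Σ r, StateSymbol L r) = ⟨r, y⟩ ∨ Free x φ

/-- The state symbol `z` is substitutable for `x` in the formula: no free occurrence of `x` lies in
the scope of a quantifier that binds `z`. -/
def Substitutable {t : L.S} (x : L.SVAR t) (z : StateSymbol L t) : {s : L.S} → Form L s → Prop
  | _, prop _ => True
  | _, sym _ => True
  | _, neg φ => Substitutable x z φ
  | _, or φ ψ => Substitutable x z φ ∧ Substitutable x z ψ
  | _, op _ φ => ∀ i, Substitutable x z (φ i)
  | _, @all _ _ r y φ => ¬ Free x (all y φ) ∨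
      ((⟨t, z⟩ : Σ r, StateSymbol L r) ≠ ⟨r, .svar y⟩ ∧ Substitutable x z φ)
  | _, sat _ _ φ => Substitutable x z φ

end Form

open Classical in
/-- `y[z/x]` for a state symbol `y`: this is `z` if `y` is `x`, and `y` otherwise. -/
noncomputable def StateSymbol.subst {L : Signature.{u}} {t : L.S} (x : L.SVAR t)
    (z : StateSymbol L t) {s : L.S} (y : StateSymbol L s) : StateSymbol L s :=
  if h : (⟨t, .svar x⟩ : Σ r, StateSymbol L r) = ⟨s, y⟩ then
    (show t = s from congrArg Sigma.fst h) ▸ z else y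

open Classical in
/-- `φ[z/x]`: the state symbol `z` replaces every free occurrence of `x` in `φ`. -/
noncomputable def Form.subst {L : Signature.{u}} {t : L.S} (x : L.SVAR t)
    (z : StateSymbol L t) : {s : L.S} → Form L s → Form L s
  | _, .prop p => .prop p
  | _, .sym y => .sym (StateSymbol.subst x z y)
  | _, .neg φ => .neg (Form.subst x z φ)
  | _, .or φ ψ => .or (Form.subst x z φ) (Form.subst x z ψ)
  | _, .op σ φ => .op σ fun i => Form.subst x z (φ i)
  | _, @Form.all _ _ r y φ =>
      if (⟨t, x⟩ : Σ r, L.SVAR r) = ⟨r, y⟩ then .all y φ else .all y (Form.subst x z φ)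
  | _, .sat s y φ => .sat s (StateSymbol.subst x z y) (Form.subst x z φ)

/-- A formula is a propositional tautology if it is true under every assignment of truth values to
the formulas of its sort that respects `¬` and `∨`. -/
def Tautology {L : Signature.{u}} {s : L.S} (φ : Form L s) : Prop :=
  ∀ v : Form L s → Prop, (∀ α, v (.neg α) ↔ ¬ v α) → (∀ α β, v (.or α β) ↔ v α ∨ v β) → v φ

open Form in
/-- The deductive system: `Provable φ` says that `φ` is a theorem. -/
inductive Provable {L : Signature.{u}} : {s : L.S} → Form L s → Prop
  -- the many-sorted polyadic modal system
  | taut {s : L.S} (φ : Form L s) : Tautology φ → Provable φ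
  | K {n : ℕ} {d : Fin n → L.S} {s : L.S} (σ : L.Op n d s) (φ : (i : Fin n) → Form L (d i))
      (i : Fin n) (α β : Form L (d i)) :
      Provable (imp (box σ (Function.update φ i (imp α β)))
        (imp (box σ (Function.update φ i α)) (box σ (Function.update φ i β))))
  | dual {n : ℕ} {d : Fin n → L.S} {s : L.S} (σ : L.Op n d s) (φ : (i : Fin n) → Form L (d i)) :
      Provable (iff (op σ φ) (neg (box σ fun i => neg (φ i))))
  | mp {s : L.S} (φ ψ : Form L s) : Provable φ → Provable (imp φ ψ) → Provable ψ
  | ug {n : ℕ} {d : Fin n → L.S} {s : L.S} (σ : L.Op n d s) (φ : (i : Fin n) → Form L (d i))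
      (i : Fin n) : Provable (φ i) → Provable (box σ φ)
  -- axioms for the satisfaction operators
  | kAt {t : L.S} (s : L.S) (z : StateSymbol L t) (φ ψ : Form L t) :
      Provable (imp (sat s z (imp φ ψ)) (imp (sat s z φ) (sat s z ψ)))
  | agree {s t' : L.S} (t : L.S) (y : StateSymbol L t') (z : StateSymbol L s) (φ : Form L s) :
      Provable (iff (sat t y (sat t' z φ)) (sat t z φ))
  | selfDual {t : L.S} (s : L.S) (z : StateSymbol L t) (φ : Form L t) :
      Provable (iff (sat s z φ) (neg (sat s z (neg φ))))
  | intro {s : L.S} (z : StateSymbol L s) (φ : Form L s) :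
      Provable (imp (sym z) (iff φ (sat s z φ)))
  | back {n : ℕ} {d : Fin n → L.S} {s t : L.S} (σ : L.Op n d s)
      (φ : (i : Fin n) → Form L (d i)) (i : Fin n) (z : StateSymbol L t) (ψ : Form L t) :
      Provable (imp (op σ (Function.update φ i (sat (d i) z ψ))) (sat s z ψ))
  | ref {t : L.S} (s : L.S) (z : StateSymbol L t) : Provable (sat s z (sym z))
  -- axioms for the binder
  | q1 {s t : L.S} (x : L.SVAR t) (φ ψ : Form L s) : ¬ Free x φ →
      Provable (imp (all x (imp φ ψ)) (imp φ (all x ψ)))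
  | q2 {s t : L.S} (x : L.SVAR t) (y : StateSymbol L t) (φ : Form L s) : Substitutable x y φ →
      Provable (imp (all x φ) (subst x y φ))
  | name {s : L.S} (x : L.SVAR s) : Provable (ex x (var x))
  | barcan {n : ℕ} {d : Fin n → L.S} {s t : L.S} (σ : L.Op n d s)
      (φ : (i : Fin n) → Form L (d i)) (i : Fin n) (x : L.SVAR t) :
      (∀ k, k ≠ i → ¬ Free x (φ k)) →
      Provable (imp (all x (box σ φ)) (box σ (Function.update φ i (all x (φ i)))))
  | barcanAt {r t : L.S} (s : L.S) (x : L.SVAR t) (z : StateSymbol L r) (φ : Form L r) :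
      (⟨t, .svar x⟩ : Σ r, StateSymbol L r) ≠ ⟨r, z⟩ →
      Provable (imp (all x (sat s z φ)) (sat s z (all x φ)))
  | nomX {t : L.S} (s : L.S) (x : L.SVAR t) (y z : StateSymbol L t) :
      Provable (imp (and (sat s z (var x)) (sat s y (var x))) (sat s z (sym y)))
  -- deduction rules
  | broadcast {s t : L.S} (s' : L.S) (z : StateSymbol L t) (φ : Form L t) :
      Provable (sat s z φ) → Provable (sat s' z φ)
  | genAt {s' : L.S} (s : L.S) (z : StateSymbol L s') (φ : Form L s') :
      Provable φ → Provable (sat s z φ)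
  | paste0 {s t : L.S} (z y : StateSymbol L t) (φ : Form L t) (ψ : Form L s) :
      z ≠ y → ¬ Occurs y φ → ¬ Occurs y ψ →
      Provable (imp (sat s z (and (sym y) φ)) ψ) → Provable (imp (sat s z φ) ψ)
  | paste1 {n : ℕ} {d : Fin n → L.S} {s t : L.S} (σ : L.Op n d t) (z : StateSymbol L t)
      (φ : (i : Fin n) → Form L (d i)) (i : Fin n) (y : StateSymbol L (d i)) (ψ : Form L s) :
      (⟨t, z⟩ : Σ r, StateSymbol L r) ≠ ⟨d i, y⟩ → (∀ k, ¬ Occurs y (φ k)) → ¬ Occurs y ψ →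
      Provable (imp (sat s z (op σ (Function.update φ i (and (sym y) (φ i))))) ψ) →
      Provable (imp (sat s z (op σ φ)) ψ)
  | gen {s t : L.S} (x : L.SVAR t) (φ : Form L s) : Provable φ → Provable (all x φ)

/-- `φ` is deducible from `Γ`: some `ψ₁ → (ψ₂ → ⋯ → (ψₘ → φ))` with `ψ₁, …, ψₘ ∈ Γ` is a
theorem. -/
def Deducible {L : Signature.{u}} {s : L.S} (Γ : Set (Form L s)) (φ : Form L s) : Prop :=
  ∃ l : List (Form L s), (∀ ψ ∈ l, ψ ∈ Γ) ∧ Provable (l.foldr Form.imp φ)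

/-- `Γ` is consistent: no contradiction is deducible from it. -/
def Consistent {L : Signature.{u}} {s : L.S} (Γ : Set (Form L s)) : Prop :=
  ¬ ∃ φ, Deducible Γ φ ∧ Deducible Γ (.neg φ)

/-- Models. A nominal is evaluated in a singleton; `VNom j` is the unique element of `V(j)`. -/
structure Model (L : Signature.{u}) where
  W : L.S → Type u
  W_nonempty : ∀ s, Nonempty (W s)
  R : {n : ℕ} → {d : Fin n → L.S} → {s : L.S} → L.Op n d s → W s → ((i : Fin n) → W (d i)) → Prop
  VProp : {s : L.S} → L.PROP s → Set (W s)
  VNom : {s : L.S} → L.NOM s → W s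

namespace Model

variable {L : Signature.{u}}

/-- Assignments of states to state variables. -/
abbrev Assignment (M : Model L) : Type u := (s : L.S) → L.SVAR s → M.W s

/-- `g'` is an `x`-variant of `g`. -/
def IsVariant {M : Model L} {s : L.S} (x : L.SVAR s) (g' g : M.Assignment) : Prop :=
  (∀ t, t ≠ s → g t = g' t) ∧ ∀ y, y ≠ x → g s y = g' s y

/-- The denotation of a state symbol. -/
def den (M : Model L) (g : M.Assignment) {s : L.S} : StateSymbol L s → M.W s
  | .nom j => M.VNom j
  | .svar x => g s x

/-- The satisfaction relation `M, g, w ⊨ φ`. -/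
def Satisfies (M : Model L) : M.Assignment → {s : L.S} → M.W s → Form L s → Prop
  | _, _, w, .prop p => w ∈ M.VProp p
  | g, _, w, .sym z => w = M.den g z
  | g, _, w, .neg φ => ¬ M.Satisfies g w φ
  | g, _, w, .or φ ψ => M.Satisfies g w φ ∨ M.Satisfies g w ψ
  | g, _, w, @Form.op _ _ d _ σ φ =>
      ∃ v : (i : _) → M.W (d i), M.R σ w v ∧ ∀ i, M.Satisfies g (v i) (φ i)
  | g, _, w, .all x φ => ∀ g' : M.Assignment, IsVariant x g' g → M.Satisfies g' w φ
  | g, _, _, .sat _ z φ => M.Satisfies g (M.den g z) φ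

end Model

/-- `Γ` is satisfiable: all its members hold at one state of one model under one assignment. -/
def Satisfiable {L : Signature.{u}} {s : L.S} (Γ : Set (Form L s)) : Prop :=
  ∃ (M : Model L) (g : M.Assignment) (w : M.W s), ∀ φ ∈ Γ, M.Satisfies g w φ

end HybridLogic

namespace HybridLogic

/-! The proof is a Henkin construction. The language is enlarged by nominals so that each pair of a
variable `x` and a formula `φ` of sort `s` gets its own witness `c`. The axioms `φ[c/x] → ∀ x φ` are
added to `Γ`, Zorn's lemma gives a maximal consistent `Δ`, and the model consists of the nominals,
with `a` and `b` identified when `@_a b ∈ Δ`.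

Witnesses are also needed for formulas that already contain witnesses. Instead of a chain of
extensions, a single inductive type `Code` holds old nominals, witnesses and codes of formulas, and
every code counts as a nominal. The rank of a code measures this nesting: a witness outranks every
nominal in its formula.

Consistency rests on `Provable.exists_finite_map`: the side conditions of a proof involve finitely
many symbols, so nominals may be turned into state variables injectively on a finite set. State
variables serve as fresh symbols because every sort has infinitely many. A fresh witness thus
becomes a fresh variable, which can be generalised, and its axiom drops out
(`Provable.of_henkin_imp`). Finitely many axioms are removed in order of decreasing rank; the
remaining new nominals are renamed away by `Provable.of_lift`.

`Δ` has formulas of sort `s` only, but describes every sort through `@_z^s`. (Barcan@) moves `∀` out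
of `@`, so witnesses at sort `s` suffice, and (Paste1) turns witnesses for `∀` into named successors
for `σ` (`IsHenkin.exists_satOpAnd`). The truth lemma is `IsHenkin.satisfies_iff`. -/

variable {L : Signature.{u}}

/-! ### Propositional reasoning through valuations -/

/-- A truth-value assignment to the formulas of sort `s` that respects `¬` and `∨`. -/
structure IsValuation {s : L.S} (v : Form L s → Prop) : Prop where
  neg : ∀ α, v (.neg α) ↔ ¬ v α
  or : ∀ α β, v (.or α β) ↔ v α ∨ v β

namespace IsValuation

variable {s : L.S} {v : Form L s → Prop}

theorem imp (h : IsValuation v) (α β : Form L s) : v (.imp α β) ↔ (v α → v β) := by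
  rw [Form.imp, h.or, h.neg, imp_iff_not_or]

theorem and (h : IsValuation v) (α β : Form L s) : v (.and α β) ↔ v α ∧ v β := by
  rw [Form.and, h.neg, h.or, h.neg, h.neg]; tauto

theorem iff (h : IsValuation v) (α β : Form L s) : v (.iff α β) ↔ (v α ↔ v β) := by
  rw [Form.iff, h.and, h.imp, h.imp]; tauto

theorem foldr_imp (h : IsValuation v) (l : List (Form L s)) (α : Form L s) :
    v (l.foldr Form.imp α) ↔ ((∀ ψ ∈ l, v ψ) → v α) := by
  induction l with
  | nil => simp
  | cons a l ih => simp only [List.foldr_cons, h.imp, ih, List.forall_mem_cons]; tauto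

end IsValuation

namespace Provable

variable {s : L.S}

/-- All tautologies are axioms, so propositional steps are checked semantically on valuations and
never derived by hand. -/
theorem of_valuation {φ : Form L s} (h : ∀ v : Form L s → Prop, IsValuation v → v φ) :
    Provable φ :=
  .taut _ fun v hn ho => h v ⟨hn, ho⟩

theorem conseq {α φ : Form L s} (hα : Provable α)
    (h : ∀ v : Form L s → Prop, IsValuation v → v α → v φ) : Provable φ :=
  .mp α _ hα (of_valuation fun v hv => (hv.imp _ _).2 (h v hv))

theorem conseq₂ {α β φ : Form L s} (hα : Provable α) (hβ : Provable β)
    (h : ∀ v : Form L s → Prop, IsValuation v → v α → v β → v φ) : Provable φ :=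
  .mp α _ hα (hβ.conseq fun v hv b => (hv.imp _ _).2 fun a => h v hv a b)

theorem conseq₃ {α β γ φ : Form L s} (hα : Provable α) (hβ : Provable β) (hγ : Provable γ)
    (h : ∀ v : Form L s → Prop, IsValuation v → v α → v β → v γ → v φ) : Provable φ :=
  .mp α _ hα (hβ.conseq₂ hγ fun v hv b c => (hv.imp _ _).2 fun a => h v hv a b c)

end Provable

/-! ### Deducibility and maximal consistent sets -/

/-- Maximal consistent sets of formulas of sort `s`. -/
structure MaximalConsistent {s : L.S} (Δ : Set (Form L s)) : Prop where
  consistent : Consistent Δ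
  maximal : ∀ Θ, Consistent Θ → Δ ⊆ Θ → Θ ⊆ Δ

section Deducible

variable {s : L.S} {Γ : Set (Form L s)}

theorem Provable.deducible {φ : Form L s} (h : Provable φ) : Deducible Γ φ := ⟨[], by simp, h⟩

theorem Deducible.of_mem {φ : Form L s} (h : φ ∈ Γ) : Deducible Γ φ :=
  ⟨[φ], by simpa, .of_valuation fun v hv => (hv.foldr_imp _ _).2 fun h => h φ (by simp)⟩

theorem Deducible.conseq₂ {α β φ : Form L s} (hα : Deducible Γ α) (hβ : Deducible Γ β)
    (h : ∀ v : Form L s → Prop, IsValuation v → v α → v β → v φ) : Deducible Γ φ := by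
  obtain ⟨l, hl, pl⟩ := hα
  obtain ⟨m, hm, pm⟩ := hβ
  refine ⟨l ++ m, fun ψ hψ => (List.mem_append.1 hψ).elim (hl ψ) (hm ψ), pl.conseq₂ pm ?_⟩
  intro v hv a b
  rw [hv.foldr_imp] at *
  exact fun H => h v hv (a fun ψ hψ => H ψ (List.mem_append_left _ hψ))
    (b fun ψ hψ => H ψ (List.mem_append_right _ hψ))

/-- Deduction theorem: all copies of `α` are deleted from the list of premises, and the antecedent
`α` stands in for them. -/
theorem Deducible.imp_of_insert {α φ : Form L s} (h : Deducible (insert α Γ) φ) :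
    Deducible Γ (.imp α φ) := by
  classical
  obtain ⟨l, hl, pl⟩ := h
  refine ⟨l.filter (· ≠ α), fun ψ hψ => ?_, pl.conseq fun v hv H => ?_⟩
  · simp only [List.mem_filter, decide_eq_true_eq] at hψ
    exact (hl ψ hψ.1).resolve_left hψ.2
  · rw [hv.foldr_imp] at *
    refine fun H' => (hv.imp _ _).2 fun a => H fun ψ hψ => ?_
    by_cases e : ψ = α
    · exact e ▸ a
    · exact H' ψ (by simp [hψ, e])

theorem deducible_of_not_consistent (h : ¬ Consistent Γ) (φ : Form L s) : Deducible Γ φ := by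
  obtain ⟨α, h1, h2⟩ := not_not.1 h
  exact h1.conseq₂ h2 fun v hv a b => absurd a ((hv.neg _).1 b)

theorem Consistent.exists_maximalConsistent (h : Consistent Γ) :
    ∃ Δ, Γ ⊆ Δ ∧ MaximalConsistent Δ := by
  suffices H : ∀ C ⊆ {Θ : Set (Form L s) | Consistent Θ}, IsChain (· ⊆ ·) C → C.Nonempty →
      ∃ ub ∈ {Θ : Set (Form L s) | Consistent Θ}, ∀ Θ ∈ C, Θ ⊆ ub by
    obtain ⟨Δ, hΔ, hm⟩ := zorn_subset_nonempty _ H Γ h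
    exact ⟨Δ, hΔ, hm.prop, fun Θ hΘ hs => hm.le_of_ge hΘ hs⟩
  intro C hC hchain hne
  refine ⟨⋃₀ C, ?_, fun _ => Set.subset_sUnion_of_mem⟩
  rintro ⟨φ, ⟨l, hl, pl⟩, ⟨m, hm, pm⟩⟩
  -- Deductions are finite, so a contradiction from the union of the chain already arises in one
  -- member.
  have key : ∀ k : List (Form L s), (∀ ψ ∈ k, ψ ∈ ⋃₀ C) → ∃ Θ ∈ C, ∀ ψ ∈ k, ψ ∈ Θ := by
    intro k hk
    induction k with
    | nil => exact ⟨hne.some, hne.some_mem, by simp⟩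
    | cons a k ih =>
      obtain ⟨Θ, hΘ, H⟩ := ih fun ψ hψ => hk ψ (List.mem_cons_of_mem _ hψ)
      obtain ⟨Θ', hΘ', ha⟩ := hk a List.mem_cons_self
      obtain h | h := hchain.total hΘ hΘ'
      · exact ⟨Θ', hΘ', by simpa [ha] using fun ψ hψ => h (H ψ hψ)⟩
      · exact ⟨Θ, hΘ, by simpa [h ha] using H⟩
  obtain ⟨Θ, hΘ, H⟩ := key (l ++ m) fun ψ hψ => (List.mem_append.1 hψ).elim (hl ψ) (hm ψ)
  exact hC hΘ ⟨φ, ⟨l, fun ψ hψ => H ψ (List.mem_append_left _ hψ), pl⟩,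
    ⟨m, fun ψ hψ => H ψ (List.mem_append_right _ hψ), pm⟩⟩

end Deducible

namespace MaximalConsistent

variable {s : L.S} {Δ : Set (Form L s)}

theorem mem_of_deducible (h : MaximalConsistent Δ) {φ : Form L s} (hφ : Deducible Δ φ) :
    φ ∈ Δ := by
  refine h.maximal (insert φ Δ) ?_ (Set.subset_insert _ _) (Set.mem_insert _ _)
  rintro ⟨α, h1, h2⟩
  exact h.consistent ⟨α, hφ.conseq₂ h1.imp_of_insert fun v hv a b => (hv.imp _ _).1 b a,
    hφ.conseq₂ h2.imp_of_insert fun v hv a b => (hv.imp _ _).1 b a⟩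

theorem mem_of_provable (h : MaximalConsistent Δ) {φ : Form L s} (hφ : Provable φ) : φ ∈ Δ :=
  h.mem_of_deducible hφ.deducible

theorem mem_neg (h : MaximalConsistent Δ) (α : Form L s) : Form.neg α ∈ Δ ↔ α ∉ Δ := by
  refine ⟨fun h1 h2 => h.consistent ⟨α, .of_mem h2, .of_mem h1⟩, fun hα => ?_⟩
  by_contra hn
  refine hα (h.maximal (insert α Δ) ?_ (Set.subset_insert _ _) (Set.mem_insert _ _))
  rintro ⟨β, h1, h2⟩
  refine hn (h.mem_of_deducible (h1.imp_of_insert.conseq₂ h2.imp_of_insert fun v hv a b => ?_))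
  rw [hv.imp] at a b
  exact (hv.neg _).2 fun c => (hv.neg _).1 (b c) (a c)

theorem isValuation (h : MaximalConsistent Δ) : IsValuation (· ∈ Δ) where
  neg := h.mem_neg
  or α β := by
    have key : ∀ {φ ψ χ : Form L s}, φ ∈ Δ → ψ ∈ Δ →
        (∀ v : Form L s → Prop, IsValuation v → v φ → v ψ → v χ) → χ ∈ Δ :=
      fun h1 h2 H => h.mem_of_deducible ((Deducible.of_mem h1).conseq₂ (.of_mem h2) H)
    refine ⟨fun h1 => or_iff_not_imp_left.2 fun h2 => ?_, fun h1 => ?_⟩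
    · exact key h1 ((h.mem_neg _).2 h2) fun v hv a b =>
        ((hv.or _ _).1 a).resolve_left ((hv.neg _).1 b)
    · obtain h1 | h1 := h1
      · exact key h1 h1 fun v hv a _ => (hv.or _ _).2 (.inl a)
      · exact key h1 h1 fun v hv a _ => (hv.or _ _).2 (.inr a)

end MaximalConsistent

/-! ### Occurrences and substitution -/

/-- State symbols of arbitrary sort. -/
abbrev Symbol (L : Signature.{u}) : Type u := Σ r, StateSymbol L r

namespace StateSymbol

theorem subst_self {t : L.S} (x : L.SVAR t) (z : StateSymbol L t) :
    subst x z (.svar x) = z := by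
  rw [subst, dif_pos rfl]

theorem subst_of_ne {s t : L.S} {x : L.SVAR t} (z : StateSymbol L t) {y : StateSymbol L s}
    (h : (⟨t, .svar x⟩ : Symbol L) ≠ ⟨s, y⟩) : subst x z y = y := by
  rw [subst, dif_neg h]

theorem subst_subst {s t : L.S} {x y : L.SVAR t} {w : StateSymbol L s}
    (h : (⟨t, .svar y⟩ : Symbol L) ≠ ⟨s, w⟩) :
    subst y (.svar x) (subst x (.svar y) w) = w := by
  by_cases e : (⟨t, .svar x⟩ : Symbol L) = ⟨s, w⟩
  · cases e
    rw [subst_self, subst_self]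
  · rw [subst_of_ne _ e, subst_of_ne _ h]

end StateSymbol

namespace Form

theorem finite_occurs {s : L.S} (φ : Form L s) : {p : Symbol L | Occurs p.2 φ}.Finite := by
  induction φ with
  | prop p => simp [Occurs]
  | sym z => exact (Set.finite_singleton ⟨_, z⟩).subset fun p hp => hp
  | neg φ ih => exact ih
  | or φ ψ ih1 ih2 => exact ih1.union ih2
  | op σ φ ih => exact (Set.finite_iUnion ih).subset fun p hp => Set.mem_iUnion.2 hp
  | all x φ ih => exact (ih.insert ⟨_, .svar x⟩).subset fun p hp => hp
  | sat s z φ ih => exact (ih.insert ⟨_, z⟩).subset fun p hp => hp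

theorem Free.occurs {t : L.S} {x : L.SVAR t} {s : L.S} {φ : Form L s} (h : Free x φ) :
    Occurs (.svar x) φ := by
  induction φ with
  | prop p => exact h
  | sym z => exact h
  | neg φ ih => exact ih h
  | or φ ψ ih1 ih2 => exact h.imp ih1 ih2
  | op σ φ ih => exact h.imp ih
  | all y φ ih => exact .inr (ih h.2)
  | sat s z φ ih => exact h.imp id ih

section Subst

variable {t : L.S} {x : L.SVAR t}

theorem subst_of_not_free (z : StateSymbol L t) {s : L.S} {φ : Form L s} (h : ¬ Free x φ) :
    subst x z φ = φ := by
  induction φ with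
  | prop p => rfl
  | sym y => rw [subst, StateSymbol.subst_of_ne _ h]
  | neg φ ih => rw [subst, ih h]
  | or φ ψ ih1 ih2 => rw [subst, ih1 fun H => h (.inl H), ih2 fun H => h (.inr H)]
  | op σ φ ih => rw [subst]; congr 1; exact funext fun i => ih i fun H => h ⟨i, H⟩
  | all y φ ih =>
    rw [subst]
    split_ifs with e
    · rfl
    · rw [ih fun H => h ⟨e, H⟩]
  | sat s y φ ih =>
    rw [subst, StateSymbol.subst_of_ne _ fun H => h (.inl H), ih fun H => h (.inr H)]

theorem substitutable_of_not_occurs {z : StateSymbol L t} {s : L.S} {φ : Form L s}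
    (h : ¬ Occurs z φ) : Substitutable x z φ := by
  induction φ with
  | prop p => trivial
  | sym y => trivial
  | neg φ ih => exact ih h
  | or φ ψ ih1 ih2 => exact ⟨ih1 fun H => h (.inl H), ih2 fun H => h (.inr H)⟩
  | op σ φ ih => exact fun i => ih i fun H => h ⟨i, H⟩
  | all y φ ih => exact .inr ⟨fun H => h (.inl H), ih fun H => h (.inr H)⟩
  | sat s y φ ih => exact ih fun H => h (.inr H)

theorem substitutable_nom (j : L.NOM t) {s : L.S} (φ : Form L s) :
    Substitutable x (.nom j) φ := by
  induction φ with
  | prop p => trivial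
  | sym y => trivial
  | neg φ ih => exact ih
  | or φ ψ ih1 ih2 => exact ⟨ih1, ih2⟩
  | op σ φ ih => exact ih
  | all y φ ih =>
    refine .inr ⟨fun h => ?_, ih⟩
    cases h
  | sat s y φ ih => exact ih

theorem substitutable_of_not_free {z : StateSymbol L t} {s : L.S} {φ : Form L s}
    (h : ¬ Free x φ) : Substitutable x z φ := by
  induction φ with
  | prop p => trivial
  | sym y => trivial
  | neg φ ih => exact ih h
  | or φ ψ ih1 ih2 => exact ⟨ih1 fun H => h (.inl H), ih2 fun H => h (.inr H)⟩
  | op σ φ ih => exact fun i => ih i fun H => h ⟨i, H⟩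
  | all y φ ih => exact .inl h
  | sat s y φ ih => exact ih fun H => h (.inr H)

variable {y : L.SVAR t}

theorem subst_subst {s : L.S} {φ : Form L s} (h : ¬ Occurs (.svar y) φ) :
    subst y (.svar x) (subst x (.svar y) φ) = φ := by
  induction φ with
  | prop p => rfl
  | sym w => rw [subst, subst, StateSymbol.subst_subst h]
  | neg φ ih => rw [subst, subst, ih h]
  | or φ ψ ih1 ih2 => rw [subst, subst, ih1 fun H => h (.inl H), ih2 fun H => h (.inr H)]
  | op σ φ ih => rw [subst, subst]; congr 1; exact funext fun i => ih i fun H => h ⟨i, H⟩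
  | @all _ r w φ ih =>
    rw [subst]
    split_ifs with e
    · exact subst_of_not_free _ fun H => h H.occurs
    · rw [subst, if_neg, ih fun H => h (.inr H)]
      intro H
      cases H
      exact h (.inl rfl)
  | sat s w φ ih =>
    rw [subst, subst, StateSymbol.subst_subst fun H => h (.inl H), ih fun H => h (.inr H)]

/-- Under a quantifier `∀ x` nothing was replaced, so `y` has no occurrence there and `x` can be put
back without capture. -/
theorem substitutable_subst {s : L.S} {φ : Form L s} (h : ¬ Occurs (.svar y) φ) :
    Substitutable y (.svar x) (subst x (.svar y) φ) := by
  induction φ with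
  | prop p => trivial
  | sym y => trivial
  | neg φ ih => exact ih h
  | or φ ψ ih1 ih2 => exact ⟨ih1 fun H => h (.inl H), ih2 fun H => h (.inr H)⟩
  | op σ φ ih => exact fun i => ih i fun H => h ⟨i, H⟩
  | @all _ r w φ ih =>
    rw [subst]
    split_ifs with e
    · exact substitutable_of_not_free fun H => h H.occurs
    · refine .inr ⟨fun H => e ?_, ih fun H => h (.inr H)⟩
      cases H
      rfl
  | sat s y φ ih => exact ih fun H => h (.inr H)

end Subst

end Form

/-! ### Renaming the nominals of a proof -/

/-- The signature `L` with its nominals replaced by `N`. -/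
abbrev Signature.withNom (L : Signature.{u}) (N : L.S → Type u) : Signature.{u} :=
  { L with NOM := N }

section Map

variable {N : L.S → Type u} (ρ : ∀ s, N s → StateSymbol L s)

/-- Replacement of nominals by state symbols. -/
def StateSymbol.map {s : L.S} : StateSymbol (L.withNom N) s → StateSymbol L s
  | .nom j => ρ s j
  | .svar x => .svar x

/-- `StateSymbol.map` on the state symbols of all sorts. -/
def Symbol.map (p : Symbol (L.withNom N)) : Symbol L := ⟨p.1, p.2.map ρ⟩

/-- Replacement of the nominals in a formula by state symbols. -/
def Form.map : {s : L.S} → Form (L.withNom N) s → Form L s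
  | _, .prop p => .prop p
  | _, .sym z => .sym (z.map ρ)
  | _, .neg φ => .neg φ.map
  | _, .or φ ψ => .or φ.map ψ.map
  | _, .op σ φ => .op (L := L) σ fun i => (φ i).map
  | _, .all x φ => .all (L := L) x φ.map
  | _, .sat s z φ => .sat (L := L) s (z.map ρ) φ.map

theorem Form.map_update {n : ℕ} {d : Fin n → L.S} (φ : ∀ i, Form (L.withNom N) (d i)) (i : Fin n)
    (α : Form (L.withNom N) (d i)) :
    (fun k => (Function.update φ i α k).map ρ) =
      Function.update (fun k => (φ k).map ρ) i (α.map ρ) :=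
  funext fun k => Function.apply_update (fun _ => Form.map ρ) φ i α k


section InjOn

variable {F : Set (Symbol (L.withNom N))}

/-- Occurrence is a disjunction of equalities between symbols of `F`, and injectivity on `F`
reflects each of them. The next lemmas transfer the other side conditions of the calculus in the
same way. -/
theorem Form.occurs_map (hF : Set.InjOn (Symbol.map ρ) F) {t : L.S}
    {z : StateSymbol (L.withNom N) t} (hz : ⟨t, z⟩ ∈ F) {s : (L.withNom N).S} {φ : Form (L.withNom N) s}
    (hφ : {p : Symbol (L.withNom N) | Occurs p.2 φ} ⊆ F) :
    Occurs (z.map ρ) (φ.map ρ) ↔ Occurs z φ := by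
  induction φ with
  | prop p => rfl
  | @sym r y => exact hF.eq_iff hz (hφ (a := ⟨r, y⟩) (Eq.refl _))
  | neg φ ih => exact ih hφ
  | or φ ψ ih1 ih2 =>
    exact or_congr (ih1 fun p h => hφ (Or.inl h)) (ih2 fun p h => hφ (Or.inr h))
  | op σ φ ih => exact exists_congr fun i => ih i fun p h => hφ ⟨i, h⟩
  | @all _ r x φ ih =>
    exact or_congr (hF.eq_iff hz (hφ (a := ⟨r, .svar x⟩) (Or.inl rfl)))
      (ih fun p h => hφ (Or.inr h))
  | @sat r s y φ ih =>
    exact or_congr (hF.eq_iff hz (hφ (a := ⟨r, y⟩) (Or.inl rfl))) (ih fun p h => hφ (Or.inr h))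

theorem Form.free_map (hF : Set.InjOn (Symbol.map ρ) F) {t : L.S} {x : L.SVAR t}
    (hx : ⟨t, .svar x⟩ ∈ F) {s : (L.withNom N).S} {φ : Form (L.withNom N) s}
    (hφ : {p : Symbol (L.withNom N) | Occurs p.2 φ} ⊆ F) :
    Free x (φ.map ρ) ↔ Free (L := L.withNom N) x φ := by
  induction φ with
  | prop p => rfl
  | @sym r y => exact hF.eq_iff hx (hφ (a := ⟨r, y⟩) (Eq.refl _))
  | neg φ ih => exact ih hφ
  | or φ ψ ih1 ih2 =>
    exact or_congr (ih1 fun p h => hφ (Or.inl h)) (ih2 fun p h => hφ (Or.inr h))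
  | op σ φ ih => exact exists_congr fun i => ih i fun p h => hφ ⟨i, h⟩
  | all x φ ih => exact and_congr Iff.rfl (ih fun p h => hφ (Or.inr h))
  | @sat r s y φ ih =>
    exact or_congr (hF.eq_iff hx (hφ (a := ⟨r, y⟩) (Or.inl rfl))) (ih fun p h => hφ (Or.inr h))

theorem Form.substitutable_map (hF : Set.InjOn (Symbol.map ρ) F) {t : L.S} {x : L.SVAR t}
    (hx : ⟨t, .svar x⟩ ∈ F) {z : StateSymbol (L.withNom N) t} (hz : ⟨t, z⟩ ∈ F) {s : (L.withNom N).S}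
    {φ : Form (L.withNom N) s} (hφ : {p : Symbol (L.withNom N) | Occurs p.2 φ} ⊆ F) :
    Substitutable x (z.map ρ) (φ.map ρ) ↔ Substitutable (L := L.withNom N) x z φ := by
  induction φ with
  | prop p => rfl
  | sym y => rfl
  | neg φ ih => exact ih hφ
  | or φ ψ ih1 ih2 =>
    exact and_congr (ih1 fun p h => hφ (Or.inl h)) (ih2 fun p h => hφ (Or.inr h))
  | op σ φ ih => exact forall_congr' fun i => ih i fun p h => hφ ⟨i, h⟩
  | @all _ r y φ ih =>
    exact or_congr (not_congr (free_map ρ hF hx (φ := .all y φ) hφ)) (and_congr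
      (not_congr (hF.eq_iff hz (hφ (a := ⟨r, .svar y⟩) (Or.inl rfl))))
      (ih fun p h => hφ (Or.inr h)))
  | sat s y φ ih => exact ih fun p h => hφ (Or.inr h)

theorem StateSymbol.map_subst (hF : Set.InjOn (Symbol.map ρ) F) {t : L.S} {x : L.SVAR t}
    (hx : ⟨t, .svar x⟩ ∈ F) (z : StateSymbol (L.withNom N) t) {s : (L.withNom N).S}
    {y : StateSymbol (L.withNom N) s} (hy : ⟨s, y⟩ ∈ F) :
    (subst (L := L.withNom N) x z y).map ρ = subst x (z.map ρ) (y.map ρ) := by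
  by_cases e : (⟨t, .svar x⟩ : Symbol (L.withNom N)) = ⟨s, y⟩
  · cases e
    rw [subst_self]
    exact (subst_self _ _).symm
  · rw [subst_of_ne _ e, subst_of_ne]
    exact fun H => e (hF hx hy H)

theorem Form.map_subst (hF : Set.InjOn (Symbol.map ρ) F) {t : L.S} {x : L.SVAR t}
    (hx : ⟨t, .svar x⟩ ∈ F) (z : StateSymbol (L.withNom N) t) {s : (L.withNom N).S}
    {φ : Form (L.withNom N) s} (hφ : {p : Symbol (L.withNom N) | Occurs p.2 φ} ⊆ F) :
    (subst (L := L.withNom N) x z φ).map ρ = subst x (z.map ρ) (φ.map ρ) := by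
  induction φ with
  | prop p => rfl
  | @sym s y =>
    rw [subst, map, StateSymbol.map_subst ρ hF hx z (hφ (a := ⟨s, y⟩) (Eq.refl _))]
    rfl
  | neg φ ih => exact congrArg neg (ih hφ)
  | or φ ψ ih1 ih2 =>
    exact congrArg₂ or (ih1 fun p h => hφ (Or.inl h)) (ih2 fun p h => hφ (Or.inr h))
  | op σ φ ih =>
    exact congrArg (op (L := L) σ) (funext fun i => ih i fun p h => hφ ⟨i, h⟩)
  | @all _ r y φ ih =>
    rw [subst, map, subst]
    split_ifs with e
    · rfl
    · exact congrArg (all (L := L) y) (ih fun p h => hφ (Or.inr h))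
  | @sat r s y φ ih =>
    rw [subst, map, StateSymbol.map_subst ρ hF hx z (hφ (a := ⟨r, y⟩) (Or.inl rfl)),
      ih fun p h => hφ (Or.inr h)]
    rfl

end InjOn

/-- A valuation pulled back along `Form.map` is a valuation, so no injectivity is needed. -/
theorem Tautology.map {s : (L.withNom N).S} {φ : Form (L.withNom N) s} (h : Tautology φ) :
    Tautology (φ.map ρ) :=
  fun v hn ho => h (fun α => v (α.map ρ)) (fun α => hn (α.map ρ)) fun α β => ho (α.map ρ) (β.map ρ)

/-- A proof mentions finitely many state symbols, and replacing its nominals by state symbols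
preserves it if no two of these symbols are identified. -/
theorem Provable.exists_finite_map {s : (L.withNom N).S} {φ : Form (L.withNom N) s} (h : Provable φ) :
    ∃ F : Set (Symbol (L.withNom N)), F.Finite ∧
      ∀ ρ : ∀ s, N s → StateSymbol L s, Set.InjOn (Symbol.map ρ) F → Provable (φ.map ρ) := by
  open Form in
  induction h with
  | taut φ hφ => exact ⟨∅, Set.finite_empty, fun ρ _ => .taut _ (hφ.map ρ)⟩
  | K σ φ i α β =>
    refine ⟨∅, Set.finite_empty, fun ρ _ => ?_⟩
    have := K (L := L) σ (fun k => (φ k).map ρ) i (α.map ρ) (β.map ρ)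
    change Provable (imp (box (L := L) σ (Function.update _ i (map ρ (imp α β)))) _) at this
    simp only [← map_update] at this
    exact this
  | dual σ φ => exact ⟨∅, Set.finite_empty, fun ρ _ => dual (L := L) σ fun k => (φ k).map ρ⟩
  | mp φ ψ _ _ ih1 ih2 =>
    obtain ⟨F, hF, H⟩ := ih1
    obtain ⟨F', hF', H'⟩ := ih2
    exact ⟨F ∪ F', hF.union hF', fun ρ h => .mp _ _ (H ρ (h.mono Set.subset_union_left))
      (H' ρ (h.mono Set.subset_union_right))⟩
  | ug σ φ i _ ih =>
    obtain ⟨F, hF, H⟩ := ih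
    exact ⟨F, hF, fun ρ h => ug (L := L) σ (fun k => (φ k).map ρ) i (H ρ h)⟩
  | kAt s z φ ψ => exact ⟨∅, Set.finite_empty, fun ρ _ => kAt (L := L) s (z.map ρ) _ _⟩
  | agree t y z φ =>
    exact ⟨∅, Set.finite_empty, fun ρ _ => agree (L := L) t (y.map ρ) (z.map ρ) _⟩
  | selfDual s z φ => exact ⟨∅, Set.finite_empty, fun ρ _ => selfDual (L := L) s (z.map ρ) _⟩
  | intro z φ => exact ⟨∅, Set.finite_empty, fun ρ _ => intro (L := L) (z.map ρ) _⟩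
  | back σ φ i z ψ =>
    refine ⟨∅, Set.finite_empty, fun ρ _ => ?_⟩
    have := back (L := L) σ (fun k => (φ k).map ρ) i (z.map ρ) (ψ.map ρ)
    change Provable (imp (op _ (Function.update _ i (map ρ (sat _ z ψ)))) _) at this
    rw [← map_update] at this
    exact this
  | ref s z => exact ⟨∅, Set.finite_empty, fun ρ _ => ref (L := L) s (z.map ρ)⟩
  | @q1 s t x φ ψ hx =>
    refine ⟨_, (finite_occurs φ).insert ⟨t, .svar x⟩, fun ρ h => q1 (L := L) x _ _ ?_⟩
    exact (free_map ρ h (Set.mem_insert _ _) (Set.subset_insert _ _)).not.2 hx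
  | @q2 s t x y φ hx =>
    refine ⟨_, ((finite_occurs φ).insert ⟨t, y⟩).insert ⟨t, .svar x⟩, fun ρ h => ?_⟩
    have := q2 (L := L) x (y.map ρ) (φ.map ρ) ((substitutable_map ρ h (Set.mem_insert _ _)
      (.inr (.inl rfl)) fun p hp => .inr (.inr hp)).2 hx)
    rw [← map_subst ρ h (Set.mem_insert _ _) _ fun p hp => .inr (.inr hp)] at this
    exact this
  | name x => exact ⟨∅, Set.finite_empty, fun ρ _ => name (L := L) x⟩
  | @barcan n d s t σ φ i x hx =>
    refine ⟨_, (Set.finite_iUnion fun k => finite_occurs (φ k)).insert ⟨t, .svar x⟩, fun ρ h => ?_⟩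
    have := barcan (L := L) σ (fun k => (φ k).map ρ) i x fun k hk =>
      (free_map ρ h (Set.mem_insert _ _) fun p hp => .inr (Set.mem_iUnion.2 ⟨k, hp⟩)).not.2 (hx k hk)
    change Provable (imp _ (box _ (Function.update _ i (map ρ (all x (φ i)))))) at this
    rw [← map_update] at this
    exact this
  | @barcanAt r t s x z φ hx =>
    refine ⟨{⟨t, .svar x⟩, ⟨r, z⟩}, by simp, fun ρ h => barcanAt (L := L) s x (z.map ρ) _ ?_⟩
    exact fun H => hx (h (by simp) (by simp) H)
  | nomX s x y z => exact ⟨∅, Set.finite_empty, fun ρ _ => nomX (L := L) s x (y.map ρ) (z.map ρ)⟩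
  | broadcast s' z φ _ ih =>
    obtain ⟨F, hF, H⟩ := ih
    exact ⟨F, hF, fun ρ h => broadcast (L := L) s' (z.map ρ) _ (H ρ h)⟩
  | genAt s z φ _ ih =>
    obtain ⟨F, hF, H⟩ := ih
    exact ⟨F, hF, fun ρ h => genAt (L := L) s (z.map ρ) _ (H ρ h)⟩
  | @paste0 s t z y φ ψ hzy hφ hψ _ ih =>
    obtain ⟨F, hF, H⟩ := ih
    refine ⟨F ∪ ({⟨t, z⟩, ⟨t, y⟩} ∪ ({p | Occurs p.2 φ} ∪ {p | Occurs p.2 ψ})),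
      hF.union (.union (by simp) ((finite_occurs φ).union (finite_occurs ψ))), fun ρ h => ?_⟩
    refine paste0 (L := L) (z.map ρ) (y.map ρ) _ _ (fun e => hzy ?_)
      ((occurs_map ρ h (by simp) fun p hp => ?_).not.2 hφ)
      ((occurs_map ρ h (by simp) fun p hp => ?_).not.2 hψ) (H ρ (h.mono Set.subset_union_left))
    · have : (⟨t, z⟩ : Symbol (L.withNom N)) = ⟨t, y⟩ :=
        h (by simp) (by simp) (by rw [Symbol.map, Symbol.map]; exact congrArg _ e)
      simpa using this
    · exact .inr (.inr (.inl hp))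
    · exact .inr (.inr (.inr hp))
  | @paste1 n d s t σ z φ i y ψ hzy hφ hψ _ ih =>
    obtain ⟨F, hF, H⟩ := ih
    refine ⟨F ∪ ({⟨t, z⟩, ⟨d i, y⟩} ∪ ((⋃ k, {p | Occurs p.2 (φ k)}) ∪ {p | Occurs p.2 ψ})),
      hF.union (.union (by simp) ((Set.finite_iUnion fun k => finite_occurs (φ k)).union
        (finite_occurs ψ))), fun ρ h => ?_⟩
    have := H ρ (h.mono Set.subset_union_left)
    change Provable (imp (sat _ _ (op (L := L) σ
      fun k => map ρ (Function.update φ i (and (sym y) (φ i)) k))) _) at this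
    rw [map_update] at this
    refine paste1 (L := L) σ (z.map ρ) _ i (y.map ρ) _ (fun e => hzy ?_)
      (fun k => (occurs_map ρ h (by simp) fun p hp => ?_).not.2 (hφ k))
      ((occurs_map ρ h (by simp) fun p hp => ?_).not.2 hψ) this
    · exact h (by simp) (by simp) e
    · exact .inr (.inr (.inl (Set.mem_iUnion.2 ⟨k, hp⟩)))
    · exact .inr (.inr (.inr hp))
  | gen x φ _ ih =>
    obtain ⟨F, hF, H⟩ := ih
    exact ⟨F, hF, fun ρ h => gen (L := L) x _ (H ρ h)⟩

end Map

/-! ### Discarding a Henkin axiom with a fresh witness -/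

theorem Form.occurs_subst {t r : L.S} {x : L.SVAR t} {z : StateSymbol L t} {w : StateSymbol L r}
    {s : L.S} {φ : Form L s} (h : Occurs w (subst x z φ)) :
    (⟨r, w⟩ : Symbol L) = ⟨t, z⟩ ∨ Occurs w φ := by
  have key : ∀ {s : L.S} {y : StateSymbol L s}, (⟨r, w⟩ : Symbol L) = ⟨s, StateSymbol.subst x z y⟩ →
      (⟨r, w⟩ : Symbol L) = ⟨t, z⟩ ∨ (⟨r, w⟩ : Symbol L) = ⟨s, y⟩ := by
    intro s y h
    by_cases e : (⟨t, .svar x⟩ : Symbol L) = ⟨s, y⟩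
    · cases e
      rw [StateSymbol.subst_self] at h
      exact .inl h
    · rw [StateSymbol.subst_of_ne _ e] at h
      exact .inr h
  induction φ with
  | prop p => exact h.elim
  | sym y => exact key h
  | neg φ ih => exact ih h
  | or φ ψ ih1 ih2 => exact h.elim (fun h => (ih1 h).imp id .inl) fun h => (ih2 h).imp id .inr
  | op σ φ ih =>
    obtain ⟨i, h⟩ := h
    exact (ih i h).imp id fun h => ⟨i, h⟩
  | all y φ ih =>
    rw [subst] at h
    split_ifs at h with e
    · exact .inr h
    · exact h.elim (fun h => .inr (.inl h)) fun h => (ih h).imp id .inr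
  | sat s y φ ih => exact h.elim (fun h => (key h).imp id .inl) fun h => (ih h).imp id .inr

theorem Form.not_free_subst {t : L.S} {x : L.SVAR t} {z : StateSymbol L t} (hz : z ≠ .svar x)
    {s : L.S} (φ : Form L s) : ¬ Free x (subst x z φ) := by
  have key : ∀ {s : L.S} {y : StateSymbol L s},
      (⟨t, .svar x⟩ : Symbol L) ≠ ⟨s, StateSymbol.subst x z y⟩ := by
    intro s y
    by_cases e : (⟨t, .svar x⟩ : Symbol L) = ⟨s, y⟩
    · cases e
      rw [StateSymbol.subst_self]
      exact fun h => hz (by simpa using h.symm)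
    · rwa [StateSymbol.subst_of_ne _ e]
  induction φ with
  | prop p => exact id
  | sym y => exact key
  | neg φ ih => exact ih
  | or φ ψ ih1 ih2 => exact not_or.2 ⟨ih1, ih2⟩
  | op σ φ ih => exact not_exists.2 ih
  | all y φ ih =>
    rw [subst]
    split_ifs with e
    · exact fun h => h.1 e
    · exact fun h => ih h.2
  | sat s y φ ih => exact not_or.2 ⟨key, ih⟩

theorem exists_svar_notMem {t : L.S} [Infinite (L.SVAR t)] {F : Set (Symbol L)} (hF : F.Finite) :
    ∃ y : L.SVAR t, (⟨t, .svar y⟩ : Symbol L) ∉ F :=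
  (hF.preimage (f := fun y : L.SVAR t => (⟨t, .svar y⟩ : Symbol L))
    fun y _ y' _ h => by simpa using h).exists_notMem

theorem Provable.imp_all {s t : L.S} {x : L.SVAR t} {φ ψ : Form L s} (hx : ¬ Form.Free x φ)
    (h : Provable (.imp φ ψ)) : Provable (.imp φ (.all x ψ)) :=
  .mp _ _ (.gen x _ h) (.q1 x φ ψ hx)

/-- Change of bound variable: instantiating `y` by `x` undoes the substitution, and `x` is not free
in the antecedent, so it can be generalised. -/
theorem Provable.all_subst_imp_all {s t : L.S} {x y : L.SVAR t} {φ : Form L s}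
    (hy : ¬ Form.Occurs (.svar y) φ) (hxy : y ≠ x) :
    Provable (.imp (.all y (Form.subst x (.svar y) φ)) (.all x φ)) := by
  refine .imp_all (fun h => Form.not_free_subst (fun e => hxy (by simpa using e)) φ h.2) ?_
  have := Provable.q2 y (.svar x) _ (Form.substitutable_subst (x := x) hy)
  rwa [Form.subst_subst hy] at this

open Classical in
/-- Replacement of the nominal `c` by the state variable `y`. -/
noncomputable def replaceNom {t : L.S} (c : L.NOM t) (y : L.SVAR t) (s : L.S) (j : L.NOM s) :
    StateSymbol L s :=
  if h : (⟨t, c⟩ : Σ s, L.NOM s) = ⟨s, j⟩ then .svar ((show t = s from congrArg Sigma.fst h) ▸ y) else .nom j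

theorem replaceNom_self {t : L.S} (c : L.NOM t) (y : L.SVAR t) :
    replaceNom c y t c = .svar y := by
  rw [replaceNom, dif_pos rfl]

theorem StateSymbol.map_replaceNom {t : L.S} {c : L.NOM t} {y : L.SVAR t} {s : L.S}
    {z : StateSymbol L s} (h : (⟨t, .nom c⟩ : Symbol L) ≠ ⟨s, z⟩) :
    z.map (L := L) (replaceNom c y) = z := by
  cases z with
  | svar x => rfl
  | nom j =>
    refine dif_neg fun e => h ?_
    cases e
    rfl

theorem Form.map_replaceNom {t : L.S} {c : L.NOM t} {y : L.SVAR t} {s : L.S}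
    {φ : Form L s} (h : ¬ Occurs (.nom c) φ) : φ.map (L := L) (replaceNom c y) = φ := by
  induction φ with
  | prop p => rfl
  | sym z => exact congrArg sym (StateSymbol.map_replaceNom h)
  | neg φ ih => exact congrArg neg (ih h)
  | or φ ψ ih1 ih2 => exact congrArg₂ or (ih1 fun H => h (.inl H)) (ih2 fun H => h (.inr H))
  | op σ φ ih => exact congrArg (op σ) (funext fun i => ih i fun H => h ⟨i, H⟩)
  | all x φ ih => exact congrArg (all x) (ih fun H => h (.inr H))
  | sat s z φ ih =>
    exact congrArg₂ (sat s) (StateSymbol.map_replaceNom fun H => h (.inl H))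
      (ih fun H => h (.inr H))

/-- The only collision the replacement could cause is between `c` and `y`, and `y` lies outside `F`.
-/
theorem injOn_map_replaceNom {t : L.S} {c : L.NOM t} {y : L.SVAR t} {F : Set (Symbol L)}
    (hy : (⟨t, .svar y⟩ : Symbol L) ∉ F) :
    Set.InjOn (Symbol.map (L := L) (replaceNom c y)) F := by
  have key : ∀ p ∈ F, ∀ q ∈ F, Symbol.map (L := L) (replaceNom c y) p =
      Symbol.map (L := L) (replaceNom c y) q → p = ⟨t, .nom c⟩ → p = q := by
    rintro p hp ⟨s, z⟩ hq h rfl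
    by_contra e
    rw [Symbol.map, Symbol.map] at h
    erw [StateSymbol.map_replaceNom e] at h
    simp only [StateSymbol.map] at h
    erw [replaceNom_self] at h
    exact hy (h ▸ hq)
  intro p hp q hq h
  by_cases e : p = ⟨t, .nom c⟩
  · exact key p hp q hq h e
  by_cases e' : q = ⟨t, .nom c⟩
  · exact (key q hq p hp h.symm e').symm
  · obtain ⟨s, z⟩ := p
    obtain ⟨s', z'⟩ := q
    rw [Symbol.map, Symbol.map] at h
    erw [StateSymbol.map_replaceNom (Ne.symm e), StateSymbol.map_replaceNom (Ne.symm e')] at h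
    exact h

/-- A Henkin axiom for a nominal that occurs nowhere else can be discarded. -/
theorem Provable.of_henkin_imp {s t : L.S} [Infinite (L.SVAR t)] {c : L.NOM t} {x : L.SVAR t}
    {φ θ : Form L s} (hφ : ¬ Form.Occurs (.nom c) φ) (hθ : ¬ Form.Occurs (.nom c) θ)
    (h : Provable (.imp (.imp (Form.subst x (.nom c) φ) (.all x φ)) θ)) : Provable θ := by
  obtain ⟨F, hF, H⟩ := Provable.exists_finite_map (L := L) (N := L.NOM) h
  obtain ⟨y, hy⟩ := exists_svar_notMem (t := t)
    (hF.union (((Form.finite_occurs φ).insert ⟨t, .svar x⟩).union (Form.finite_occurs θ)))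
  simp only [Set.mem_union, Set.mem_insert_iff, not_or] at hy
  have := H (replaceNom c y) (injOn_map_replaceNom hy.1)
  have e : (Form.subst x (.nom c) φ).map (L := L) (replaceNom c y) = φ.subst x (.svar y) := by
    refine (Form.map_subst (L := L) (N := L.NOM) (F := insert ⟨t, .svar x⟩ {p | Form.Occurs p.2 φ})
      _ (injOn_map_replaceNom fun H => ?_) (Set.mem_insert _ _) _ (Set.subset_insert _ _)).trans ?_
    · exact H.elim hy.2.1.1 hy.2.1.2
    · rw [StateSymbol.map, replaceNom_self]
      erw [Form.map_replaceNom hφ]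
  change Provable (.imp (.imp ((Form.subst x (.nom c) φ).map (L := L) (replaceNom c y))
    (.all x (φ.map (L := L) (replaceNom c y)))) (θ.map (L := L) (replaceNom c y))) at this
  rw [e, Form.map_replaceNom hφ, Form.map_replaceNom hθ] at this
  -- If `θ` fails then `φ[y/x]` holds and `∀ x φ` fails. Generalising over the fresh `y` gives `∀ y
  -- φ[y/x]`, hence `∀ x φ`, a contradiction.
  have h1 : Provable (.imp (.neg θ) (.all y (φ.subst x (.svar y)))) :=
    .imp_all (fun H => hy.2.2 H.occurs) (this.conseq fun v hv => by
      simp only [hv.imp, hv.neg]; tauto)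
  exact this.conseq₃ h1 (.all_subst_imp_all hy.2.1.2 fun H => hy.2.1.1 (by rw [H]))
    fun v hv => by simp only [hv.imp, hv.neg]; tauto

theorem StateSymbol.nom_ne_svar {t r : L.S} (c : L.NOM t) (x : L.SVAR r) :
    (⟨t, .nom c⟩ : Symbol L) ≠ ⟨r, .svar x⟩ := by
  rintro ⟨⟩

/-! ### The language with witnesses -/

/-- Codes for the formulas over the nominals of `L` and one new nominal `wit x φ` for each state
variable `x` and each code `φ`. -/
inductive Code (L : Signature.{u}) : L.S → Type u
  | old {s : L.S} (j : L.NOM s) : Code L s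
  | wit {s t : L.S} (x : L.SVAR t) (φ : Code L s) : Code L t
  | prop {s : L.S} (p : L.PROP s) : Code L s
  | nom {s : L.S} (z : Code L s) : Code L s
  | svar {s : L.S} (x : L.SVAR s) : Code L s
  | neg {s : L.S} (φ : Code L s) : Code L s
  | or {s : L.S} (φ ψ : Code L s) : Code L s
  | op {n : ℕ} {d : Fin n → L.S} {s : L.S} (σ : L.Op n d s)
      (φ : (i : Fin n) → Code L (d i)) : Code L s
  | all {s t : L.S} (x : L.SVAR t) (φ : Code L s) : Code L s
  | sat {t : L.S} (s : L.S) (z ψ : Code L t) : Code L s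

/-- The extension of `L` by witnesses: every code is a nominal. -/
abbrev Signature.henkin (L : Signature.{u}) : Signature.{u} := L.withNom (Code L)

namespace Code

/-- The height of a code. -/
def rank : {s : L.S} → Code L s → ℕ
  | _, old _ => 0
  | _, wit _ φ => φ.rank + 1
  | _, prop _ => 0
  | _, nom z => z.rank + 1
  | _, svar _ => 0
  | _, neg φ => φ.rank + 1
  | _, or φ ψ => max φ.rank ψ.rank + 1
  | _, op _ φ => (Finset.univ.sup fun i => (φ i).rank) + 1
  | _, all _ φ => φ.rank + 1
  | _, sat _ z φ => max z.rank φ.rank + 1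

/-- The code of a state symbol. -/
def ofSymbol {s : L.S} : StateSymbol L.henkin s → Code L s
  | .nom c => nom c
  | .svar x => svar x

/-- The code of a formula. -/
def ofForm : {s : L.S} → Form L.henkin s → Code L s
  | _, .prop p => prop p
  | _, .sym z => ofSymbol z
  | _, .neg φ => neg (ofForm φ)
  | _, .or φ ψ => or (ofForm φ) (ofForm ψ)
  | _, .op σ φ => op (L := L) σ fun i => ofForm (φ i)
  | _, .all x φ => all (L := L) x (ofForm φ)
  | _, .sat s z φ => sat (L := L) s (ofSymbol (L := L) z) (ofForm φ)

theorem ofSymbol_injective {s : L.S} : Function.Injective (ofSymbol (L := L) (s := s)) := by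
  intro a b h
  cases a <;> cases b <;> simp only [ofSymbol, reduceCtorEq, nom.injEq, svar.injEq] at h <;> rw [h]

/-- Needed so that different Henkin axioms have different witnesses. -/
theorem ofForm_injective {s : L.henkin.S} : Function.Injective (ofForm (L := L) (s := s)) := by
  intro φ ψ h
  induction φ with
  | prop p =>
    cases ψ with
    | sym z => cases z <;> simp [ofForm, ofSymbol] at h
    | _ => simp_all [ofForm]
  | sym z =>
    cases ψ with
    | sym w => rw [ofSymbol_injective h]
    | _ => cases z <;> simp [ofForm, ofSymbol] at h
  | neg φ ih =>
    cases ψ with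
    | sym z => cases z <;> simp [ofForm, ofSymbol] at h
    | neg ψ => rw [ih (by simpa [ofForm] using h)]
    | _ => simp [ofForm] at h
  | or φ φ' ih1 ih2 =>
    cases ψ with
    | sym z => cases z <;> simp [ofForm, ofSymbol] at h
    | or ψ ψ' =>
      simp only [ofForm, or.injEq] at h
      rw [ih1 h.1, ih2 h.2]
    | _ => simp [ofForm] at h
  | op σ φ ih =>
    cases ψ with
    | sym z => cases z <;> simp [ofForm, ofSymbol] at h
    | op τ ψ =>
      simp only [ofForm] at h
      injection h with h1 h2 h3 h4 h5
      subst h1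
      cases h2
      cases h4
      exact congrArg _ (funext fun i => ih i (congrFun (eq_of_heq h5) i))
    | _ => simp [ofForm] at h
  | all x φ ih =>
    cases ψ with
    | sym z => cases z <;> simp [ofForm, ofSymbol] at h
    | all y ψ =>
      simp only [ofForm] at h
      injection h with h1 h2 h3 h4
      subst h2
      cases h3
      rw [ih h4]
    | _ => simp [ofForm] at h
  | sat s z φ ih =>
    cases ψ with
    | sym z => cases z <;> simp [ofForm, ofSymbol] at h
    | sat s w ψ =>
      simp only [ofForm] at h
      injection h with h1 h2 h3 h4
      subst h1
      rw [ih (eq_of_heq h4), ofSymbol_injective (eq_of_heq h3)]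
    | _ => simp [ofForm] at h

/-- The constructor `nom` raises the rank, so a nominal ranks strictly below any formula containing
it; this is what makes witnesses fresh. -/
theorem rank_lt_of_occurs {t : L.S} {c : Code L t} {s : L.henkin.S}
    {φ : Form L.henkin s} (h : Form.Occurs (.nom c) φ) : c.rank < (ofForm φ).rank := by
  have key : ∀ {s : L.S} {z : StateSymbol L.henkin s},
      (⟨t, .nom c⟩ : Symbol L.henkin) = ⟨s, z⟩ → c.rank < (ofSymbol z).rank := by
    intro s z h
    cases h
    exact Nat.lt_succ_self _
  induction φ with
  | prop p => exact h.elim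
  | sym z => exact key h
  | neg φ ih => exact Nat.lt_succ_of_lt (ih h)
  | or φ ψ ih1 ih2 =>
    exact Nat.lt_succ_of_lt (h.elim (fun h => lt_max_of_lt_left (ih1 h))
      fun h => lt_max_of_lt_right (ih2 h))
  | op σ φ ih =>
    obtain ⟨i, h⟩ := h
    exact Nat.lt_succ_of_lt ((ih i h).trans_le
      (Finset.le_sup (f := fun i => (ofForm (φ i)).rank) (Finset.mem_univ i)))
  | all x φ ih => exact Nat.lt_succ_of_lt (ih (h.resolve_left (by rintro ⟨⟩)))
  | sat s z φ ih =>
    exact Nat.lt_succ_of_lt (h.elim (fun h => lt_max_of_lt_left (key h))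
      fun h => lt_max_of_lt_right (ih h))

end Code

/-! ### Conservativity of the enlarged language -/

/-- A formula over `L` as a formula over `L.henkin`. -/
def Form.lift {s : L.S} (φ : Form L s) : Form L.henkin s :=
  Form.map (L := L.henkin) (N := L.NOM) (fun _ j => .nom (.old j)) φ

theorem Form.not_occurs_lift {t : L.S} {c : Code L t} (hc : ∀ j, c ≠ .old j) {s : L.S}
    (φ : Form L s) : ¬ Occurs (.nom c) φ.lift := by
  have key : ∀ {s : L.S} (z : StateSymbol L s), (⟨t, .nom c⟩ : Symbol L.henkin) ≠
      ⟨s, z.map (L := L.henkin) (N := L.NOM) (fun _ j => .nom (.old j))⟩ := by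
    intro s z h
    cases z with
    | nom j => cases h; exact hc j rfl
    | svar x => cases h
  induction φ with
  | prop p => exact id
  | sym z => exact key z
  | neg φ ih => exact ih
  | or φ ψ ih1 ih2 => exact not_or.2 ⟨ih1, ih2⟩
  | op σ φ ih => exact not_exists.2 ih
  | all x φ ih => exact not_or.2 ⟨by rintro ⟨⟩, ih⟩
  | sat s z φ ih => exact not_or.2 ⟨key z, ih⟩

theorem Form.map_lift {ρ : ∀ s, Code L s → StateSymbol L s} (hρ : ∀ s j, ρ s (.old j) = .nom j)
    {s : L.S} (φ : Form L s) : φ.lift.map ρ = φ := by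
  have key : ∀ {s : L.S} (z : StateSymbol L s),
      (z.map (L := L.henkin) (N := L.NOM) (fun _ j => .nom (.old j))).map ρ = z := by
    intro s z
    cases z with
    | nom j => exact hρ s j
    | svar x => rfl
  induction φ with
  | prop p => rfl
  | sym z => exact congrArg sym (key z)
  | neg φ ih => exact congrArg neg ih
  | or φ ψ ih1 ih2 => exact congrArg₂ or ih1 ih2
  | op σ φ ih => exact congrArg (op σ) (funext ih)
  | all x φ ih => exact congrArg (all x) ih
  | sat s z φ ih => exact congrArg₂ (sat s) (key z) ih

open Classical in
-- Old nominals are renamed to themselves and all other codes to variables outside the finite set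
-- `F`. This is injective on `F` and undoes the lift.
theorem Provable.of_lift [∀ s : L.S, Infinite (L.SVAR s)] {s : L.S} {φ : Form L s}
    (h : Provable φ.lift) : Provable φ := by
  obtain ⟨F, hF, H⟩ := Provable.exists_finite_map (L := L) (N := Code L) h
  have hf : ∀ s : L.S, ∃ f : Code L s → L.SVAR s,
      Set.InjOn f {c | (⟨s, .nom c⟩ : Symbol L.henkin) ∈ F} ∧
        ∀ c, (⟨s, .svar (f c)⟩ : Symbol L.henkin) ∉ F := by
    intro s
    have h1 : {c : Code L s | (⟨s, .nom c⟩ : Symbol L.henkin) ∈ F}.Finite :=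
      hF.preimage (f := fun c : Code L s => (⟨s, .nom c⟩ : Symbol L.henkin))
        fun y _ y' _ h => by simpa using h
    have h2 : {x : L.SVAR s | (⟨s, .svar x⟩ : Symbol L.henkin) ∈ F}.Finite :=
      hF.preimage (f := fun x : L.SVAR s => (⟨s, .svar x⟩ : Symbol L.henkin))
        fun y _ y' _ h => by simpa using h
    -- The finitely many nominals of `F` of this sort are numbered, and the numbers are embedded
    -- into the variables that avoid `F`. Codes outside `F` may collide.
    have := h2.infinite_compl.to_subtype
    obtain ⟨g, hg⟩ := Set.countable_iff_exists_injOn.1 h1.countable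
    let e := Infinite.natEmbedding ↑({x : L.SVAR s | (⟨s, .svar x⟩ : Symbol L.henkin) ∈ F}ᶜ)
    exact ⟨fun c => e (g c), fun a ha b hb h => hg ha hb (e.injective (Subtype.ext h)),
      fun c => (e (g c)).2⟩
  choose f hf hf' using hf
  let ρ : ∀ s, Code L s → StateSymbol L s :=
    fun s c => if h : ∃ j, c = .old j then .nom h.choose else .svar (f s c)
  have h1 : ∀ s j, ρ s (.old j) = .nom j := by
    intro s j
    have : ∃ j', Code.old j = .old j' := ⟨j, rfl⟩
    have h2 := this.choose_spec
    simp only [ρ, dif_pos this, StateSymbol.nom.injEq]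
    injection h2 with _ h2
    exact h2.symm
  have h2 : ∀ s c, (∀ j, c ≠ .old j) → ρ s c = .svar (f s c) :=
    fun s c hc => dif_neg (not_exists.2 hc)
  have := H ρ ?_
  · rwa [Form.map_lift h1] at this
  rintro ⟨s, a⟩ ha ⟨s', b⟩ hb h
  obtain rfl : s = s' := congrArg Sigma.fst h
  have h : a.map ρ = b.map ρ := by simpa [Symbol.map] using h
  cases a with
  | svar x =>
    cases b with
    | svar y => simpa [StateSymbol.map] using h
    | nom c =>
      by_cases hc : ∃ j, c = .old j
      · obtain ⟨j, rfl⟩ := hc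
        simp [StateSymbol.map, h1] at h
      · simp only [StateSymbol.map, h2 s c (not_exists.1 hc), StateSymbol.svar.injEq] at h
        exact absurd (h ▸ ha) (hf' s c)
  | nom c =>
    by_cases hc : ∃ j, c = .old j
    · obtain ⟨j, rfl⟩ := hc
      cases b with
      | svar y => simp [StateSymbol.map, h1] at h
      | nom c' =>
        by_cases hc' : ∃ j, c' = .old j
        · obtain ⟨j, rfl⟩ := hc'
          simpa [StateSymbol.map, h1] using h
        · simp [StateSymbol.map, h1, h2 s c' (not_exists.1 hc')] at h
    · cases b with
      | svar y =>
        simp only [StateSymbol.map, h2 s c (not_exists.1 hc), StateSymbol.svar.injEq] at h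
        exact absurd (h ▸ hb) (hf' s c)
      | nom c' =>
        by_cases hc' : ∃ j, c' = .old j
        · obtain ⟨j, rfl⟩ := hc'
          simp [StateSymbol.map, h1, h2 s c (not_exists.1 hc)] at h
        · simp only [StateSymbol.map, h2 s c (not_exists.1 hc), h2 s c' (not_exists.1 hc'),
            StateSymbol.svar.injEq] at h
          rw [hf s ha hb h]

/-! ### Consistency of the Henkin axioms -/

/-- Pairs of a state variable and a formula of sort `s`, the data of a Henkin axiom. -/
abbrev HenkinIndex (L : Signature.{u}) (s : L.S) : Type u := (Σ t, L.SVAR t) × Form L.henkin s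

namespace HenkinIndex

variable {s : L.S}

/-- The witness for `∀ x φ`. -/
def witness (a : HenkinIndex L s) : Code L a.1.1 := .wit a.1.2 (.ofForm a.2)

/-- The Henkin axiom `φ[c/x] → ∀ x φ`, where `c` is the witness for `∀ x φ`. -/
noncomputable def axm (a : HenkinIndex L s) : Form L.henkin s :=
  .imp (Form.subst (L := L.henkin) a.1.2 (.nom a.witness) a.2) (.all (L := L.henkin) a.1.2 a.2)

theorem witness_injective {a b : HenkinIndex L s}
    (h : (⟨a.1.1, .nom a.witness⟩ : Symbol L.henkin) = ⟨b.1.1, .nom b.witness⟩) : a = b := by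
  obtain ⟨⟨t, x⟩, φ⟩ := a
  obtain ⟨⟨t', x'⟩, φ'⟩ := b
  dsimp only [witness] at h
  cases congrArg Sigma.fst h
  simp only [Sigma.mk.injEq, heq_eq_eq, StateSymbol.nom.injEq, Code.wit.injEq, true_and] at h
  rw [h.1, Code.ofForm_injective h.2]

theorem not_occurs_witness (a : HenkinIndex L s) : ¬ Form.Occurs (.nom a.witness) a.2 :=
  fun h => (Nat.lt_succ_self _).not_gt (Code.rank_lt_of_occurs h)

/-- A nominal of `b.axm` is either the witness of `b`, which differs from that of `a`, or occurs in
`b.2` and so ranks below `b.2`, while the witness of `a` ranks above `a.2`. -/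
theorem not_occurs_axm {a b : HenkinIndex L s} (hab : a ≠ b)
    (h : (Code.ofForm b.2).rank ≤ (Code.ofForm a.2).rank) :
    ¬ Form.Occurs (.nom a.witness) b.axm := by
  have key : ¬ Form.Occurs (.nom a.witness) b.2 := fun H =>
    (Code.rank_lt_of_occurs H).not_ge (h.trans (Nat.le_succ _))
  rintro (H | H | H)
  · exact (Form.occurs_subst H).elim (fun H => hab (witness_injective H)) key
  · exact StateSymbol.nom_ne_svar (L := L.henkin) _ _ H
  · exact key H

end HenkinIndex

theorem Form.not_occurs_foldr_imp {s t : L.S} {z : StateSymbol L t} {l : List (Form L s)}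
    (hl : ∀ ψ ∈ l, ¬ Occurs z ψ) {φ : Form L s} (hφ : ¬ Occurs z φ) :
    ¬ Occurs z (l.foldr imp φ) := by
  induction l with
  | nil => exact hφ
  | cons a l ih =>
    rw [List.forall_mem_cons] at hl
    exact not_or.2 ⟨hl.1, ih hl.2⟩

open Classical in
theorem Deducible.of_lift_union_henkin [∀ s : L.S, Infinite (L.SVAR s)] {s : L.S}
    {Γ : Set (Form L s)} {φ : Form L s}
    (h : Deducible (Form.lift '' Γ ∪ Set.range (HenkinIndex.axm (L := L) (s := s))) φ.lift) :
    Deducible Γ φ := by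
  have key : ∀ P : Finset (HenkinIndex L s),
      Deducible (Form.lift '' Γ ∪ HenkinIndex.axm '' (P : Set (HenkinIndex L s))) φ.lift →
      Deducible (Form.lift '' Γ) φ.lift := by
    intro P
    -- The axiom whose formula has greatest rank is removed first: its witness occurs in no other
    -- axiom of the finite set.
    refine Finset.induction_on_max_value (fun a : HenkinIndex L s => (Code.ofForm a.2).rank) P
      (by simp) fun a P ha hmax ih H => ih ?_
    rw [Finset.coe_insert, Set.image_insert_eq, Set.union_insert] at H
    obtain ⟨l, hl, pl⟩ := H.imp_of_insert
    have hold : ∀ ψ : Form L s, ¬ Form.Occurs (.nom a.witness) ψ.lift :=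
      Form.not_occurs_lift fun j h => by cases h
    refine ⟨l, hl, Provable.of_henkin_imp (L := L.henkin) (t := a.1.1) (c := a.witness)
      (x := a.1.2) (φ := a.2) a.not_occurs_witness
      (Form.not_occurs_foldr_imp (fun ψ hψ => ?_) (hold φ)) (pl.conseq fun v hv H => ?_)⟩
    · obtain ⟨ψ, -, rfl⟩ | ⟨b, hb, rfl⟩ := hl ψ hψ
      · exact hold ψ
      · exact HenkinIndex.not_occurs_axm (fun e => ha (e ▸ hb)) (hmax b hb)
    · rw [hv.foldr_imp, hv.imp] at H
      rw [hv.imp, hv.foldr_imp]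
      exact fun h1 h2 => H h2 h1
  have : ∃ P : Finset (HenkinIndex L s),
      Deducible (Form.lift '' Γ ∪ HenkinIndex.axm '' (P : Set (HenkinIndex L s))) φ.lift := by
    obtain ⟨l, hl, pl⟩ := h
    have : ∀ ψ : Form L.henkin s, ∃ P : Finset (HenkinIndex L s), ψ ∈ l →
        ψ ∈ Form.lift '' Γ ∪ HenkinIndex.axm '' (P : Set (HenkinIndex L s)) := by
      intro ψ
      by_cases hψ : ψ ∈ l
      · obtain h | ⟨a, rfl⟩ := hl ψ hψ
        · exact ⟨∅, fun _ => .inl h⟩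
        · exact ⟨{a}, fun _ => .inr ⟨a, by simp, rfl⟩⟩
      · exact ⟨∅, fun h => absurd h hψ⟩
    choose P hP using this
    refine ⟨l.toFinset.biUnion P, l, fun ψ hψ => ?_, pl⟩
    refine (hP ψ hψ).imp id fun h => Set.image_mono ?_ h
    exact Finset.coe_subset.2 (Finset.subset_biUnion_of_mem P (List.mem_toFinset.2 hψ))
  obtain ⟨P, hP⟩ := this
  obtain ⟨l, hl, pl⟩ := key P hP
  obtain ⟨k, hk, rfl⟩ : ∃ k : List (Form L s), (∀ ψ ∈ k, ψ ∈ Γ) ∧ k.map Form.lift = l := by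
    clear pl
    induction l with
    | nil => exact ⟨[], by simp, rfl⟩
    | cons a l ih =>
      rw [List.forall_mem_cons] at hl
      obtain ⟨k, hk, rfl⟩ := ih hl.2
      obtain ⟨b, hb, rfl⟩ := hl.1
      exact ⟨b :: k, List.forall_mem_cons.2 ⟨hb, hk⟩, rfl⟩
  refine ⟨k, hk, Provable.of_lift ?_⟩
  convert pl using 1
  clear pl hl hk
  induction k with
  | nil => rfl
  | cons a k ih => exact congrArg (Form.imp a.lift) ih

theorem Consistent.lift_union_henkin [∀ s : L.S, Infinite (L.SVAR s)] {s : L.S}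
    {Γ : Set (Form L s)} (h : Consistent Γ) :
    Consistent (Form.lift '' Γ ∪ Set.range (HenkinIndex.axm (L := L) (s := s))) := by
  intro H
  have hd := deducible_of_not_consistent (not_not.2 H)
  -- Any formula of `L` would do: an inconsistent set yields the lifts of both `α` and its negation.
  let α : Form L s := .var (Classical.arbitrary (L.SVAR s))
  exact h ⟨α, .of_lift_union_henkin (hd _), .of_lift_union_henkin (hd (.lift (.neg α)))⟩

/-! ### Operations over disjunctions, formula size, pasted formulas -/

namespace Provable

open Form

/-- The contrapositive `¬β → (¬γ → ¬α)` passes through the dual operation by (UG) and two uses of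
(K); (Dual) translates back. -/
theorem op_or {n : ℕ} {d : Fin n → L.S} {t : L.S} (σ : L.Op n d t) (φ : ∀ i, Form L (d i))
    (i : Fin n) {α β γ : Form L (d i)} (h : Provable (imp α (or β γ))) :
    Provable (imp (op σ (Function.update φ i α))
      (or (op σ (Function.update φ i β)) (op σ (Function.update φ i γ)))) := by
  have hd : ∀ θ, Provable (iff (op σ (Function.update φ i θ))
      (neg (box σ (Function.update (fun k => neg (φ k)) i (neg θ))))) := by
    intro θ
    have := dual σ (Function.update φ i θ)
    rwa [show (fun k => neg (Function.update φ i θ k)) =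
      Function.update (fun k => neg (φ k)) i (neg θ) from
      funext fun k => Function.apply_update (fun _ => neg) φ i θ k] at this
  have h1 : Provable (box σ (Function.update (fun k => neg (φ k)) i
      (imp (neg β) (imp (neg γ) (neg α))))) := by
    refine ug σ _ i ?_
    rw [Function.update_self]
    exact h.conseq fun v hv => by simp only [hv.imp, hv.neg, hv.or]; tauto
  have h2 := mp _ _ h1 (K σ _ i _ _)
  have h3 := h2.conseq₂ (φ := imp (box σ (Function.update (fun k => neg (φ k)) i (neg β)))
    (imp (box σ (Function.update (fun k => neg (φ k)) i (neg γ)))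
      (box σ (Function.update (fun k => neg (φ k)) i (neg α))))) (K σ _ i _ _)
    fun v hv => by simp only [hv.imp]; tauto
  refine ((hd α).conseq₃ (hd β) (hd γ) fun v hv a b c => ?_ : Provable (imp (imp
    (box σ (Function.update (fun k => neg (φ k)) i (neg β)))
    (imp (box σ (Function.update (fun k => neg (φ k)) i (neg γ)))
      (box σ (Function.update (fun k => neg (φ k)) i (neg α))))) _)) |> mp _ _ h3
  rw [hv.iff, hv.neg] at a b c
  rw [hv.imp, hv.imp, hv.imp, hv.imp, hv.or, a, b, c]
  tauto

theorem op_mono {n : ℕ} {d : Fin n → L.S} {t : L.S} (σ : L.Op n d t) (φ : ∀ i, Form L (d i))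
    (i : Fin n) {α β : Form L (d i)} (h : Provable (imp α β)) :
    Provable (imp (op σ (Function.update φ i α)) (op σ (Function.update φ i β))) :=
  (op_or σ φ i (β := β) (γ := β) (h.conseq fun v hv => by
    simp only [hv.imp, hv.or]; tauto)).conseq fun v hv => by simp only [hv.imp, hv.or]; tauto

end Provable

namespace Form

/-- The height of a formula. -/
def size : {s : L.S} → Form L s → ℕ
  | _, prop _ => 0
  | _, sym _ => 0
  | _, neg φ => φ.size + 1
  | _, or φ ψ => max φ.size ψ.size + 1
  | _, op _ φ => (Finset.univ.sup fun i => (φ i).size) + 1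
  | _, all _ φ => φ.size + 1
  | _, sat _ _ φ => φ.size + 1

/-- In the truth lemma the quantifier case recurs on `φ[c/x]`, which is not a subformula of `∀ x φ`
but is smaller in size. -/
theorem size_subst {t : L.S} (x : L.SVAR t) (z : StateSymbol L t) {s : L.S} (φ : Form L s) :
    (subst x z φ).size = φ.size := by
  induction φ with
  | prop p => rfl
  | sym y => rfl
  | neg φ ih => exact congrArg (· + 1) ih
  | or φ ψ ih1 ih2 => rw [subst, size, size, ih1, ih2]
  | op σ φ ih => simp only [subst, size, ih]
  | all y φ ih =>
    rw [subst]
    split_ifs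
    · rfl
    · exact congrArg (· + 1) ih
  | sat s y φ ih => exact congrArg (· + 1) ih

/-- `@_z^s σ (φ₁, …, w ∧ φᵢ, …, φₙ)`. -/
def satOpAnd {n : ℕ} {d : Fin n → L.S} {t : L.S} (s : L.S) (z : StateSymbol L t)
    (σ : L.Op n d t) (φ : ∀ i, Form L (d i)) (i : Fin n) (w : StateSymbol L (d i)) : Form L s :=
  sat s z (op σ (Function.update φ i (and (sym w) (φ i))))

theorem subst_satOpAnd {n : ℕ} {d : Fin n → L.S} {s t : L.S} {z : StateSymbol L t}
    {σ : L.Op n d t} {φ : ∀ i, Form L (d i)} {i : Fin n} {x : L.SVAR (d i)}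
    (hx : ¬ Occurs (.svar x) (sat s z (op σ φ))) (w : StateSymbol L (d i)) :
    subst x w (satOpAnd s z σ φ i (.svar x)) = satOpAnd s z σ φ i w := by
  have hφ : ∀ k, subst x w (φ k) = φ k :=
    fun k => subst_of_not_free _ fun h => hx (.inr ⟨k, h.occurs⟩)
  rw [satOpAnd, subst, subst, StateSymbol.subst_of_ne _ fun h => hx (.inl h), satOpAnd]
  congr 2
  funext k
  obtain rfl | hk := eq_or_ne k i
  · rw [Function.update_self, Function.update_self, and, subst, subst, subst, subst, subst, hφ,
      StateSymbol.subst_self]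
    rfl
  · rw [Function.update_of_ne hk, Function.update_of_ne hk, hφ]

theorem occurs_satOpAnd {n : ℕ} {d : Fin n → L.S} {s t r : L.S} {z : StateSymbol L t}
    {σ : L.Op n d t} {φ : ∀ i, Form L (d i)} {i : Fin n} {w : StateSymbol L (d i)}
    {y : StateSymbol L r} (h : Occurs y (satOpAnd s z σ φ i w)) :
    (⟨r, y⟩ : Symbol L) = ⟨d i, w⟩ ∨ Occurs y (sat s z (op σ φ)) := by
  obtain h | ⟨k, h⟩ := h
  · exact .inr (.inl h)
  obtain rfl | hk := eq_or_ne k i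
  · rw [Function.update_self] at h
    exact h.imp id fun h => .inr ⟨k, h⟩
  · rw [Function.update_of_ne hk] at h
    exact .inr (.inr ⟨k, h⟩)

end Form

/-! ### Henkin sets -/

/-- A maximal consistent set with witnesses for universal quantifiers. -/
structure IsHenkin {s : L.S} (Δ : Set (Form L s)) : Prop extends MaximalConsistent Δ where
  exists_witness : ∀ {t : L.S} (x : L.SVAR t) (φ : Form L s),
    ∃ c : L.NOM t, Form.subst x (.nom c) φ ∈ Δ → Form.all x φ ∈ Δ

namespace IsHenkin

open Form

variable {s : L.S} {Δ : Set (Form L s)}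

theorem mem_iff (h : IsHenkin Δ) {α β : Form L s} (hp : Provable (iff α β)) : α ∈ Δ ↔ β ∈ Δ :=
  (h.isValuation.iff _ _).1 (h.mem_of_provable hp)

theorem mem_imp (h : IsHenkin Δ) {α β : Form L s} (hp : Provable (imp α β)) : α ∈ Δ → β ∈ Δ :=
  (h.isValuation.imp _ _).1 (h.mem_of_provable hp)

/-- By (SelfDual), (Gen@) and (K@), what `Δ` says at `z` is again a classical theory, although `z`
may have any sort. -/
theorem isValuation_sat (h : IsHenkin Δ) {t : L.S} (z : StateSymbol L t) :
    IsValuation fun φ => sat s z φ ∈ Δ := by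
  have hn : ∀ α, sat s z (neg α) ∈ Δ ↔ sat s z α ∉ Δ := fun α => by
    rw [h.mem_iff (.selfDual s z α), h.mem_neg, not_not]
  have hi : ∀ {α β}, Provable (imp α β) → sat s z α ∈ Δ → sat s z β ∈ Δ := fun hp =>
    h.mem_imp (.mp _ _ (.genAt s z _ hp) (.kAt s z _ _))
  refine ⟨hn, fun α β => ⟨fun ho => ?_, ?_⟩⟩
  · refine or_iff_not_imp_left.2 fun ha => ?_
    exact (h.isValuation.imp _ _).1 (h.mem_imp (.kAt s z (neg α) β)
      (hi (.of_valuation fun v hv => by simp only [hv.imp, hv.neg, hv.or]; tauto) ho)) ((hn α).2 ha)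
  · rintro (ha | hb)
    · exact hi (.of_valuation fun v hv => by simp only [hv.imp, hv.or]; tauto) ha
    · exact hi (.of_valuation fun v hv => by simp only [hv.imp, hv.or]; tauto) hb

theorem sat_mem (h : IsHenkin Δ) {t : L.S} (z : StateSymbol L t) {φ : Form L t}
    (hφ : Provable φ) : sat s z φ ∈ Δ := h.mem_of_provable (.genAt s z _ hφ)

theorem sat_imp (h : IsHenkin Δ) {t : L.S} {z : StateSymbol L t} {φ ψ : Form L t}
    (hφ : Provable (imp φ ψ)) : sat s z φ ∈ Δ → sat s z ψ ∈ Δ :=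
  ((h.isValuation_sat z).imp _ _).1 (h.sat_mem z hφ)

theorem sat_sat (h : IsHenkin Δ) {t r : L.S} (z : StateSymbol L t) (y : StateSymbol L r)
    (φ : Form L r) : sat s z (sat t y φ) ∈ Δ ↔ sat s y φ ∈ Δ := h.mem_iff (.agree s z y φ)

theorem sat_sym_self (h : IsHenkin Δ) {t : L.S} (z : StateSymbol L t) : sat s z (sym z) ∈ Δ :=
  h.mem_of_provable (.ref s z)

theorem sat_congr (h : IsHenkin Δ) {t : L.S} {z y : StateSymbol L t} (hz : sat s z (sym y) ∈ Δ)
    (φ : Form L t) : sat s z φ ∈ Δ ↔ sat s y φ ∈ Δ := by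
  rw [← h.sat_sat z y φ]
  exact ((h.isValuation_sat z).iff _ _).1 (h.sat_imp (.intro y φ) hz)

theorem sat_symm (h : IsHenkin Δ) {t : L.S} {z y : StateSymbol L t} (hz : sat s z (sym y) ∈ Δ) :
    sat s y (sym z) ∈ Δ := (h.sat_congr hz _).1 (h.sat_sym_self z)

theorem sat_back (h : IsHenkin Δ) {n : ℕ} {d : Fin n → L.S} {t r : L.S} {σ : L.Op n d t}
    {z : StateSymbol L t} {φ : ∀ i, Form L (d i)} {i : Fin n} {y : StateSymbol L r} {ψ : Form L r}
    (hz : sat s z (op σ (Function.update φ i (sat (d i) y ψ))) ∈ Δ) : sat s y ψ ∈ Δ :=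
  (h.sat_sat z y ψ).1 (h.sat_imp (.back σ φ i y ψ) hz)

theorem all_mem (h : IsHenkin Δ) {t : L.S} (x : L.SVAR t) (φ : Form L s) :
    all x φ ∈ Δ ↔ ∀ c : L.NOM t, subst x (.nom c) φ ∈ Δ :=
  ⟨fun H c => h.mem_imp (.q2 x (.nom c) φ (substitutable_nom c φ)) H, fun H =>
    let ⟨c, hc⟩ := h.exists_witness x φ
    hc (H c)⟩

/-- (Barcan@) brings the quantifier in front of `@`, where the witnesses of sort `s` apply; a
nominal index is never the bound variable. -/
theorem sat_all_mem (h : IsHenkin Δ) {t r : L.S} (x : L.SVAR t) (z : L.NOM r) (φ : Form L r) :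
    sat s (.nom z) (all x φ) ∈ Δ ↔ ∀ c : L.NOM t, sat s (.nom z) (subst x (.nom c) φ) ∈ Δ := by
  refine ⟨fun H c => h.sat_imp (.q2 x (.nom c) φ (substitutable_nom c φ)) H, fun H => ?_⟩
  have hz := (StateSymbol.nom_ne_svar z x).symm
  refine h.mem_imp (.barcanAt s x (.nom z) φ hz) ((h.all_mem x _).2 fun c => ?_)
  rw [subst, StateSymbol.subst_of_ne _ hz]
  exact H c

/-- (Name) refutes `∀ x ¬ x`, so the witness for this formula names the point described by `Δ`. -/
theorem exists_nom_mem (h : IsHenkin Δ) (x : L.SVAR s) :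
    ∃ c : L.NOM s, sym (.nom c) ∈ Δ := by
  obtain ⟨c, hc⟩ := h.exists_witness x (neg (var x))
  have := (h.mem_neg _).1 (h.mem_of_provable (.name x))
  refine ⟨c, by_contra fun H => this (hc ?_)⟩
  rw [subst, var, subst, StateSymbol.subst_self]
  exact (h.mem_neg _).2 H

theorem nonempty_nom (h : IsHenkin Δ) {t : L.S} (x : L.SVAR t) : Nonempty (L.NOM t) :=
  -- The formula is a dummy of sort `s`; only the existence of its witness matters.
  let ⟨c, _⟩ := h.exists_witness x (sat s (.svar x) (var x))
  ⟨c⟩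

theorem sat_op_of_sym (h : IsHenkin Δ) {n : ℕ} {d : Fin n → L.S} {t : L.S} {σ : L.Op n d t}
    {z : StateSymbol L t} {φ : ∀ i, Form L (d i)} {c : ∀ i, StateSymbol L (d i)}
    (hz : sat s z (op σ fun i => sym (c i)) ∈ Δ) (hc : ∀ i, sat s (c i) (φ i) ∈ Δ) :
    sat s z (op σ φ) ∈ Δ := by
  suffices H : ∀ I : Finset (Fin n),
      sat s z (op σ fun i => if i ∈ I then φ i else sym (c i)) ∈ Δ by
    simpa using H Finset.univ
  intro I
  induction I using Finset.induction_on with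
  | empty => simpa
  | insert a I ha ih =>
    -- One coordinate at a time, `c a` is weakened to `φ a ∨ @_(c a) ¬ φ a`. The operation splits
    -- over the disjunction, and (Back) makes the second alternative contradict `hc a`.
    have hp : Provable (imp (sym (c a)) (or (φ a) (sat (d a) (c a) (neg (φ a))))) :=
      (Provable.intro (c a) (neg (φ a))).conseq fun v hv => by
        simp only [hv.imp, hv.iff, hv.or, hv.neg]; tauto
    have h1 := Provable.op_or σ (fun i => if i ∈ I then φ i else sym (c i)) a hp
    rw [Function.update_eq_self_iff.2 (by simp [ha])] at h1
    obtain h2 | h2 := ((h.isValuation_sat z).or _ _).1 (h.sat_imp h1 ih)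
    · convert h2 using 3
      funext i
      obtain rfl | hia := eq_or_ne i a
      · simp
      · simp [hia]
    · exact absurd (hc a) (((h.isValuation_sat (c a)).neg _).1 (h.sat_back h2))

variable [∀ s : L.S, Infinite (L.SVAR s)]

/-- Otherwise `∀ y ¬ @_y x` belongs to `Δ`, and putting `x` for `y` contradicts (Ref). -/
theorem exists_sat_sym (h : IsHenkin Δ) {t : L.S} (x : L.SVAR t) :
    ∃ c : L.NOM t, sat s (.nom c) (var x) ∈ Δ := by
  obtain ⟨y, hy⟩ := exists_svar_notMem (t := t) (Set.finite_singleton (⟨t, .svar x⟩ : Symbol L))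
  have hy : (⟨t, .svar y⟩ : Symbol L) ≠ ⟨t, .svar x⟩ := hy
  have key : ∀ w, subst y w (neg (sat s (.svar y) (var x))) = neg (sat s w (var x)) := by
    intro w
    rw [subst, subst, StateSymbol.subst_self, var, subst, StateSymbol.subst_of_ne _ hy]
  by_contra! H
  have h1 : all y (neg (sat s (.svar y) (var x))) ∈ Δ :=
    (h.all_mem y _).2 fun c => by rw [key]; exact (h.mem_neg _).2 (H c)
  have h2 := h.mem_imp (.q2 y (.svar x) (neg (sat s (.svar y) (var x))) trivial) h1
  rw [key] at h2
  exact (h.mem_neg _).1 h2 (h.sat_sym_self _)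

/-- (Paste1) with a fresh `y` puts `∃ x @_z σ(…, x ∧ φᵢ, …)` in `Δ`, and a Henkin witness then
replaces `x` by a nominal. -/
theorem exists_satOpAnd (h : IsHenkin Δ) {n : ℕ} {d : Fin n → L.S} {t : L.S} {σ : L.Op n d t}
    {z : StateSymbol L t} {φ : ∀ i, Form L (d i)} (hz : sat s z (op σ φ) ∈ Δ) (i : Fin n) :
    ∃ c : L.NOM (d i), satOpAnd s z σ φ i (.nom c) ∈ Δ := by
  have hfin := finite_occurs (sat s z (op σ φ))
  obtain ⟨x, hx⟩ := exists_svar_notMem (t := d i) hfin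
  obtain ⟨y, hy⟩ := exists_svar_notMem (t := d i) (hfin.insert ⟨d i, .svar x⟩)
  simp only [Set.mem_insert_iff, not_or] at hy
  have hy' : ¬ Occurs (.svar y) (all x (neg (satOpAnd s z σ φ i (.svar x)))) := by
    rintro (H | H)
    · exact hy.1 H
    · exact (occurs_satOpAnd H).elim hy.1 hy.2
  have h1 : Provable (imp (satOpAnd s z σ φ i (.svar y))
      (neg (all x (neg (satOpAnd s z σ φ i (.svar x)))))) := by
    have := Provable.q2 x (.svar y) (neg (satOpAnd s z σ φ i (.svar x)))
      (substitutable_of_not_occurs fun H => hy' (.inr H))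
    rw [subst, subst_satOpAnd hx] at this
    exact this.conseq fun v hv => by simp only [hv.imp, hv.neg]; tauto
  have h2 := h.mem_imp (.paste1 σ z φ i (.svar y)
    (neg (all x (neg (satOpAnd s z σ φ i (.svar x))))) (fun H => hy.2 (.inl H.symm))
    (fun k H => hy.2 (.inr ⟨k, H⟩)) hy' h1) hz
  by_contra! H
  refine (h.mem_neg _).1 h2 ((h.all_mem x _).2 fun c => ?_)
  rw [subst, subst_satOpAnd hx]
  exact (h.mem_neg _).2 (H c)

theorem exists_sat_op_sym (h : IsHenkin Δ) {n : ℕ} {d : Fin n → L.S} {t : L.S} {σ : L.Op n d t}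
    {z : StateSymbol L t} {φ : ∀ i, Form L (d i)} (hz : sat s z (op σ φ) ∈ Δ) :
    ∃ c : ∀ i, L.NOM (d i), sat s z (op σ fun i => sym (.nom (c i))) ∈ Δ ∧
      ∀ i, sat s (.nom (c i)) (φ i) ∈ Δ := by
  suffices H : ∀ I : Finset (Fin n), ∃ c : ∀ i, L.NOM (d i),
      sat s z (op σ fun i => if i ∈ I then sym (.nom (c i)) else φ i) ∈ Δ ∧
        ∀ i ∈ I, sat s (.nom (c i)) (φ i) ∈ Δ by
    simpa using H Finset.univ
  intro I
  induction I using Finset.induction_on with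
  | empty =>
    exact ⟨fun i => (h.nonempty_nom (Classical.arbitrary (L.SVAR (d i)))).some, by simpa, by simp⟩
  | insert a I ha ih =>
    obtain ⟨c, hc, hI⟩ := ih
    obtain ⟨e, he⟩ := h.exists_satOpAnd hc a
    rw [satOpAnd, if_neg ha] at he
    have h1 := h.sat_imp (.op_mono σ _ a (β := sym (.nom e))
      (.of_valuation fun v hv => by simp only [hv.imp, hv.and]; tauto)) he
    -- From `e ∧ φ a`, (Intro) gives `@_e φ a`, and (Back) carries it out of the operation.
    have h2 := h.sat_back (h.sat_imp (.op_mono σ _ a (β := sat (d a) (.nom e) (φ a))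
      ((Provable.intro (.nom e) (φ a)).conseq fun v hv => by
        simp only [hv.imp, hv.and, hv.iff]; tauto)) he)
    refine ⟨Function.update c a e, ?_, fun i hi => ?_⟩
    · convert h1 using 3
      funext i
      obtain rfl | hia := eq_or_ne i a
      · simp
      · simp [hia]
    · obtain rfl | hia := eq_or_ne i a
      · simpa
      · simpa [hia] using hI i ((Finset.mem_insert.1 hi).resolve_left hia)

end IsHenkin

/-! ### Semantics of substituting a nominal -/

namespace Model

variable {M : Model L}

open Classical in
/-- The assignment `g` with the value of `x` changed to `w`. -/
noncomputable def Assignment.set (g : M.Assignment) {t : L.S} (x : L.SVAR t) (w : M.W t) :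
    M.Assignment :=
  Function.update g t (Function.update (g t) x w)

namespace Assignment

variable (g : M.Assignment) {t : L.S} (x : L.SVAR t) (w : M.W t)

theorem set_self : g.set x w t x = w := by simp [set]

theorem set_of_ne {r : L.S} {y : L.SVAR r} (h : (⟨t, x⟩ : Σ r, L.SVAR r) ≠ ⟨r, y⟩) :
    g.set x w r y = g r y := by
  obtain rfl | hr := eq_or_ne r t
  · have : y ≠ x := fun e => h (by rw [e])
    simp [set, this]
  · simp [set, hr]

theorem eq_of_forall {g g' : M.Assignment} (h : ∀ p : Σ r, L.SVAR r, g p.1 p.2 = g' p.1 p.2) :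
    g = g' := funext fun r => funext fun y => h ⟨r, y⟩

theorem set_set (w' : M.W t) : (g.set x w).set x w' = g.set x w' := by
  simp [set]

theorem set_comm {r : L.S} {y : L.SVAR r} (h : (⟨t, x⟩ : Σ r, L.SVAR r) ≠ ⟨r, y⟩) (w' : M.W r) :
    (g.set x w).set y w' = (g.set y w').set x w := by
  refine eq_of_forall fun ⟨q, z⟩ => ?_
  by_cases h1 : (⟨t, x⟩ : Σ r, L.SVAR r) = ⟨q, z⟩
  · cases h1
    rw [set_self, set_of_ne _ _ _ h.symm, set_self]
  · rw [set_of_ne _ _ _ h1]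
    by_cases h2 : (⟨r, y⟩ : Σ r, L.SVAR r) = ⟨q, z⟩
    · cases h2
      rw [set_self, set_self]
    · rw [set_of_ne _ _ _ h2, set_of_ne _ _ _ h2, set_of_ne _ _ _ h1]

theorem isVariant_set : IsVariant x (g.set x w) g :=
  ⟨fun r hr => by simp [set, hr], fun y hy => by simp [set, hy]⟩

end Assignment

theorem IsVariant.eq_set {t : L.S} {g g' : M.Assignment} {x : L.SVAR t}
    (h : IsVariant x g' g) : g' = g.set x (g' t x) := by
  funext r y
  obtain rfl | hr := eq_or_ne r t
  · obtain rfl | hy := eq_or_ne y x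
    · rw [Assignment.set_self]
    · simp [Assignment.set, hy, h.2 y hy]
  · simp [Assignment.set, hr, h.1 r hr]

theorem satisfies_all {g : M.Assignment} {s t : L.S} {w : M.W s} {x : L.SVAR t} {φ : Form L s} :
    M.Satisfies g w (.all x φ) ↔ ∀ v : M.W t, M.Satisfies (g.set x v) w φ :=
  ⟨fun h v => h _ (g.isVariant_set x v), fun h g' hg' => hg'.eq_set ▸ h (g' t x)⟩

theorem den_subst_nom (g : M.Assignment) {s t : L.S} (x : L.SVAR t) (c : L.NOM t)
    (y : StateSymbol L s) :
    M.den g (StateSymbol.subst x (.nom c) y) = M.den (g.set x (M.VNom c)) y := by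
  by_cases e : (⟨t, .svar x⟩ : Symbol L) = ⟨s, y⟩
  · cases e
    rw [StateSymbol.subst_self, den, den, Assignment.set_self]
  · rw [StateSymbol.subst_of_ne _ e]
    cases y with
    | nom j => rfl
    | svar y => exact (g.set_of_ne x _ fun h => e (by cases h; rfl)).symm

/-- Nominals cannot be captured, so no substitutability condition appears. -/
theorem satisfies_subst_nom {g : M.Assignment} {s t : L.S} {x : L.SVAR t} {c : L.NOM t}
    {w : M.W s} {φ : Form L s} :
    M.Satisfies g w (Form.subst x (.nom c) φ) ↔ M.Satisfies (g.set x (M.VNom c)) w φ := by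
  induction φ generalizing g with
  | prop p => rfl
  | sym y => rw [Form.subst, Satisfies, Satisfies, den_subst_nom]
  | neg φ ih => exact not_congr ih
  | or φ ψ ih1 ih2 => exact or_congr ih1 ih2
  | op σ φ ih => exact exists_congr fun v => and_congr Iff.rfl (forall_congr' fun i => ih i)
  | all y φ ih =>
    rw [Form.subst]
    split_ifs with e
    · cases e
      simp only [satisfies_all, Assignment.set_set]
    · simp only [satisfies_all, ih]
      exact forall_congr' fun v => by rw [Assignment.set_comm _ _ _ e]
  | sat s y φ ih => rw [Form.subst, Satisfies, Satisfies, den_subst_nom, ih]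

end Model

/-! ### The model of nominals and the truth lemma -/

namespace IsHenkin

open Form

variable {s : L.S} {Δ : Set (Form L s)} [∀ s : L.S, Infinite (L.SVAR s)]

/-- Nominals are identified if the set contains their equality. -/
def setoid (h : IsHenkin Δ) (t : L.S) : Setoid (L.NOM t) where
  r a b := sat s (.nom a) (sym (.nom b)) ∈ Δ
  iseqv := ⟨fun _ => h.sat_sym_self _, h.sat_symm, fun hab hbc => (h.sat_congr hab _).2 hbc⟩

/-- The model whose states are the nominals up to equality. -/
def model (h : IsHenkin Δ) : Model L where
  W t := Quotient (h.setoid t)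
  W_nonempty t := (h.nonempty_nom (Classical.arbitrary (L.SVAR t))).map (Quotient.mk _)
  -- Relations and valuations ask for some representatives, so no independence of the choice has to
  -- be proved here.
  R {_ d t} σ w v := ∃ (z : L.NOM t) (c : ∀ i, L.NOM (d i)), Quotient.mk (h.setoid t) z = w ∧
    (∀ i, Quotient.mk (h.setoid (d i)) (c i) = v i) ∧
    sat s (.nom z) (op σ fun i => sym (.nom (c i))) ∈ Δ
  VProp {t} p := {w | ∃ z, Quotient.mk (h.setoid t) z = w ∧ sat s (.nom z) (prop p) ∈ Δ}
  VNom {t} j := Quotient.mk (h.setoid t) j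

/-- The state named by a nominal. -/
def state (h : IsHenkin Δ) {t : L.S} (c : L.NOM t) : h.model.W t := Quotient.mk (h.setoid t) c

theorem state_eq_iff (h : IsHenkin Δ) {t : L.S} {a b : L.NOM t} :
    h.state a = h.state b ↔ sat s (.nom a) (sym (.nom b)) ∈ Δ := Quotient.eq (r := h.setoid t)

/-- The assignment of the model. -/
noncomputable def assignment (h : IsHenkin Δ) : h.model.Assignment :=
  fun _ x => h.state (h.exists_sat_sym x).choose

theorem exists_den_eq (h : IsHenkin Δ) {t : L.S} (y : StateSymbol L t) :
    ∃ c, h.model.den h.assignment y = h.state c ∧ sat s (.nom c) (sym y) ∈ Δ := by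
  cases y with
  | nom j => exact ⟨j, rfl, h.sat_sym_self _⟩
  | svar x => exact ⟨_, rfl, (h.exists_sat_sym x).choose_spec⟩

theorem satisfies_iff (h : IsHenkin Δ) {t : L.S} (φ : Form L t) (z : L.NOM t) :
    h.model.Satisfies h.assignment (h.state z) φ ↔ sat s (.nom z) φ ∈ Δ := by
  induction hn : φ.size using Nat.strong_induction_on generalizing t with
  | _ n ih =>
  have ih : ∀ {r : L.S} (ψ : Form L r), ψ.size < φ.size → ∀ c : L.NOM r,
      h.model.Satisfies h.assignment (h.state c) ψ ↔ sat s (.nom c) ψ ∈ Δ :=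
    fun ψ hψ c => ih _ (hn ▸ hψ) ψ c rfl
  clear hn
  cases φ with
  | prop p =>
    refine ⟨fun ⟨c, hc, hp⟩ => (h.sat_congr (h.state_eq_iff.1 hc) _).1 hp, fun hp => ⟨z, rfl, hp⟩⟩
  | sym y =>
    obtain ⟨c, hc, hy⟩ := h.exists_den_eq y
    rw [Model.Satisfies, hc, h.state_eq_iff]
    exact ⟨fun hz => (h.sat_congr hz _).2 hy, fun hz => (h.sat_congr hz _).2 (h.sat_symm hy)⟩
  | neg φ => exact (not_congr (ih φ (Nat.lt_succ_self _) z)).trans ((h.isValuation_sat _).neg _).symm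
  | or φ ψ =>
    exact (or_congr (ih φ (Nat.lt_succ_of_le (le_max_left _ _)) z)
      (ih ψ (Nat.lt_succ_of_le (le_max_right _ _)) z)).trans ((h.isValuation_sat _).or _ _).symm
  | op σ φ =>
    have ih : ∀ i c, h.model.Satisfies h.assignment (h.state c) (φ i) ↔
        sat s (.nom c) (φ i) ∈ Δ := fun i => ih (φ i) (Nat.lt_succ_of_le
      (Finset.le_sup (f := fun i => (φ i).size) (Finset.mem_univ i)))
    constructor
    · rintro ⟨v, ⟨z', c, hz, hc, hR⟩, hv⟩
      refine (h.sat_congr (h.state_eq_iff.1 hz) _).1 (h.sat_op_of_sym hR fun i => ?_)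
      rw [← ih, show h.state (c i) = v i from hc i]
      exact hv i
    · intro hz
      obtain ⟨c, hR, hc⟩ := h.exists_sat_op_sym hz
      exact ⟨fun i => h.state (c i), ⟨z, c, rfl, fun _ => rfl, hR⟩, fun i => (ih i _).2 (hc i)⟩
  | all x φ =>
    rw [Model.satisfies_all, h.sat_all_mem]
    -- The induction keeps one fixed assignment: changing `x` to a named state amounts to
    -- substituting the name.
    have key : ∀ c, h.model.Satisfies (h.assignment.set x (h.state c)) (h.state z) φ ↔
        sat s (.nom z) (subst x (.nom c) φ) ∈ Δ := fun c => by
      rw [← ih _ ((size_subst x _ φ).trans_lt (Nat.lt_succ_self _))]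
      exact Model.satisfies_subst_nom.symm
    simp only [← key]
    -- Every state is named, so the quantifier over states becomes one over nominals.
    exact (Quotient.mk_surjective (s := h.setoid _)).forall
  | sat r y φ =>
    obtain ⟨c, hc, hy⟩ := h.exists_den_eq y
    rw [Model.Satisfies, hc, ih φ (Nat.lt_succ_self _), h.sat_sat, h.sat_congr hy]

theorem exists_model (h : IsHenkin Δ) :
    ∃ (M : Model L) (g : M.Assignment) (w : M.W s), ∀ φ ∈ Δ, M.Satisfies g w φ := by
  obtain ⟨c, hc⟩ := h.exists_nom_mem (Classical.arbitrary (L.SVAR s))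
  refine ⟨h.model, h.assignment, h.state c, fun φ hφ => (h.satisfies_iff φ c).2 ?_⟩
  exact ((h.isValuation.iff _ _).1 (h.mem_imp (.intro (.nom c) φ) hc)).1 hφ

end IsHenkin

/-! ### Return to the original language -/

/-- The restriction of a model to the nominals of `L`. -/
def Model.restrict (M : Model L.henkin) : Model L where
  W := M.W
  W_nonempty := M.W_nonempty
  R σ := M.R σ
  VProp p := M.VProp p
  VNom j := M.VNom (.old j)

theorem Model.satisfies_restrict (M : Model L.henkin) (g : M.Assignment) {s : L.S} (w : M.W s)
    (φ : Form L s) : M.restrict.Satisfies g w φ ↔ M.Satisfies g w φ.lift := by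
  have hd : ∀ (g : M.Assignment) {s : L.S} (z : StateSymbol L s), M.restrict.den g z =
      M.den g (z.map (L := L.henkin) (N := L.NOM) (fun _ j => .nom (.old j))) := by
    intro g s z
    cases z <;> rfl
  induction φ generalizing g with
  | prop p => rfl
  | sym z => exact iff_of_eq (congrArg (w = ·) (hd g z))
  | neg φ ih => exact not_congr (ih g w)
  | or φ ψ ih1 ih2 => exact or_congr (ih1 g w) (ih2 g w)
  | op σ φ ih =>
    exact exists_congr fun v => and_congr Iff.rfl (forall_congr' fun i => ih i g (v i))
  | all x φ ih => exact forall_congr' fun g' => imp_congr Iff.rfl (ih g' w)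
  | sat s z φ ih =>
    change M.restrict.Satisfies g (M.restrict.den g z) φ ↔ _
    rw [hd]
    exact ih g _

end HybridLogic

theorem mainTheorem3 (L : HybridLogic.Signature.{u}) (hSVAR : ∀ s : L.S, Infinite (L.SVAR s))
    (s : L.S) (Γ : Set (HybridLogic.Form L s)) (hΓ : HybridLogic.Consistent Γ) :
    HybridLogic.Satisfiable Γ := by
  obtain ⟨Δ, hΔ, hmax⟩ := hΓ.lift_union_henkin.exists_maximalConsistent
  have hH : HybridLogic.IsHenkin Δ := by
    refine { hmax with exists_witness := fun {t} x φ => ?_ }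
    let a : HybridLogic.HenkinIndex L s := (⟨t, x⟩, φ)
    exact ⟨a.witness, (hmax.isValuation.imp _ _).1 (hΔ (.inr ⟨a, rfl⟩))⟩
  have : ∀ s : L.henkin.S, Infinite (L.henkin.SVAR s) := hSVAR
  obtain ⟨M, g, w, H⟩ := hH.exists_model
  exact ⟨M.restrict, g, w, fun φ hφ =>
    (M.satisfies_restrict g w φ).2 (H _ (hΔ (.inl ⟨φ, hφ, rfl⟩)))⟩
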